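/- \textbf{Setting.} Let $H_1,H_2$ be separable complex Hilbert spaces, $\Omega_1,\Omega_2$ (possibly unbounded) self-adjoint operators in $H_1,H_2$, and $\Gamma:H_2\to H_1$ a bounded operator. On $\mathcal H=H_1\oplus H_2$ let $$\Omega=\begin{pmatrix}\Omega_1&\Gamma\\ \Gamma^\dagger&\Omega_2\end{pmatrix},\qquad \mathrm{Dom}\,\Omega=\mathrm{Dom}\,\Omega_1\oplus\mathrm{Dom}\,\Omega_2 .$$ For a self-adjoint operator $A$ and a set $S$ of vectors, $\mathcal O_A(S)$ is the closure of $\mathrm{span}\{f(A)w: f\in C_c(\mathbb R),\,w\in S\}$; a subspace $K$ is $A$-invariant if $\mathcal O_A(K)=K$. An \emph{s-invariant decomposition} is $\mathcal H=\bigoplus_\alpha(H_{1\alpha}\oplus H_{2\alpha})$, where $H_1=\bigoplus_\alpha H_{1\alpha}$ and $H_2=\bigoplus_\alpha H_{2\alpha}$ are (finite or infinite) orthogonal decompositions into closed subspaces and each $H_{1\alpha}\oplus H_{2\alpha}$ is $\Omega$-invariant. The system $(\mathcal H,\Omega)$ is \emph{reconstructible} if it is the minimal conservative extension of each of the two open systems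 obtained by projecting its dynamics to $H_1$ and to $H_2$, that is, $\mathcal O_\Omega(H_1)=\mathcal H=\mathcal O_\Omega(H_2)$. A \emph{singular-vector decomposition} of $\Gamma$ is a strongly convergent representation $$\Gamma=\sum_{q}\sqrt{\gamma_q}\,|g_q\rangle\langle g'_q|,\qquad \gamma_q>0,\quad \langle g_p|g_q\rangle=\langle g'_p|g'_q\rangle=\delta_{pq},$$ over a countable (possibly infinite or empty) index set. Let $U:\overline{\mathrm{Ran}\,\Gamma}\to\overline{\mathrm{Ran}\,\Gamma^\dagger}$ be the isometry of the polar decomposition $\Gamma^\dagger=U(\Gamma\Gamma^\dagger)^{1/2}$, let $H_0$ be a Hilbert space with unitary maps $U_1:H_0\to\overline{\mathrm{Ran}\,\Gamma}$ and $U_2:H_0\to\overline{\mathrm{Ran}\,\Gamma^\dagger}$ such that $U_2U_1^{-1}=U$, and let $\Gamma_0=U_1^{-1}\Gamma U_2=U_2^{-1}\Gamma^\dagger U_1$ on $H_0$. Assume that $\Gamma_0$ has pure point spectrum, i.e. its eigenvectors span a dense subspace of $H_0$. \textbf{Theorem.} \begin{enumerate} \item For every s-invariant decomposition $\mathcal H=\bigoplus_\alpha(H_{1\alpha}\oplus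 H_{2\alpha})$ there are $\gamma_q>0$ and an orthonormal family $(g_{0q})$ in $H_0$ with $\Gamma_0=\sum_q\sqrt{\gamma_q}\,|g_{0q}\rangle\langle g_{0q}|$ such that, with $g_q=U_1g_{0q}$ and $g'_q=U_2g_{0q}$, $\Gamma=\sum_q\sqrt{\gamma_q}\,|g_q\rangle\langle g'_q|$ is a singular-vector decomposition of $\Gamma$ and for every $q$ there is an $\alpha$ with $g_q\in H_{1\alpha}$ and $g'_q\in H_{2\alpha}$. \item Conversely, assume that $(\mathcal H,\Omega)$ is reconstructible and let an arbitrary singular-vector decomposition of $\Gamma$ be given. Let $G$ be the graph on the index set in which distinct $p,q$ are joined if and only if $\mathcal O_{\Omega_1}(g_p)\not\perp g_q$ or $\mathcal O_{\Omega_2}(g'_p)\not\perp g'_q$ (a symmetric condition). Let $V_\alpha$ be the vertex sets of the connected components of $G$, and put $H_{1\alpha}=\mathcal O_{\Omega_1}(\{g_q:q\in V_\alpha\})$, $H_{2\alpha}=\mathcal O_{\Omega_2}(\{g'_q:q\in V_\alpha\})$. Then \begin{enumerate} \item $\mathcal H=\bigoplus_\alpha(H_{1\alpha}\oplus H_{2\alpha})$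 is an s-invariant decomposition; \item it is the finest one such that each $g_q$ is in one of the $H_{1\alpha}$: it has this property, and if $\mathcal H=\bigoplus_\beta(H_1^\beta\oplus H_2^\beta)$ is any s-invariant decomposition with each $g_q$ in one of the $H_1^\beta$, then for every $\alpha$ there is a $\beta$ with $H_{i\alpha}\subset H_i^\beta$ for $i=1,2$. \end{enumerate} \item If $(\mathcal H,\Omega)$ is reconstructible and every eigenspace of $\Gamma\Gamma^\dagger$ for a nonzero eigenvalue is one-dimensional, then there is a unique finest s-invariant decomposition of $(\mathcal H,\Omega)$: there is exactly one s-invariant decomposition $\bigoplus_\alpha(H_{1\alpha}\oplus H_{2\alpha})$ into nonzero summands (up to the labelling of the summands) such that, for every s-invariant decomposition $\bigoplus_\beta(H_1^\beta\oplus H_2^\beta)$ and every $\alpha$, there is a $\beta$ with $H_{i\alpha}\subset H_i^\beta$ for $i=1,2$. \end{enumerate} -/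

import Mathlib

open scoped InnerProductSpace ComplexConjugate

noncomputable section

namespace OpenSystem

section Calculus

variable {H : Type*} [NormedAddCommGroup H] [InnerProductSpace ℂ H] [CompleteSpace H]

/-- `R` is the everywhere defined bounded operator `(A + i)⁻¹`, for a partially defined
operator `A`. -/
structure IsResolvent (A : H →ₗ.[ℂ] H) (R : H →L[ℂ] H) : Prop where
  right : ∀ x : H, ∃ h : R x ∈ A.domain, A ⟨R x, h⟩ + Complex.I • R x = x
  left : ∀ y : A.domain, R (A y + Complex.I • (y : H)) = y

/-- For a (possibly unbounded) self-adjoint operator `A`, the bounded operator `(A + i)⁻¹` exists,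
so that `resolventI A` below never takes its default value. -/
theorem exists_isResolvent {A : H →ₗ.[ℂ] H} (hA : IsSelfAdjoint A) :
    ∃ R : H →L[ℂ] H, IsResolvent A R := by
  have hd := hA.dense_domain
  have hadj : LinearPMap.adjoint A = A := hA
  have hsym : ∀ x y : A.domain, ⟪A x, (y : H)⟫_ℂ = ⟪(x : H), A y⟫_ℂ := by
    have h := LinearPMap.adjoint_isFormalAdjoint (T := A) hd
    rw [hadj] at h
    intro x y
    exact h x y
  let T : A.domain →ₗ[ℂ] H := A.toFun + Complex.I • A.domain.subtype
  have hT : ∀ y, T y = A y + Complex.I • (y : H) := fun y => rfl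
  have hnorm : ∀ y, ‖T y‖ ^ 2 = ‖A y‖ ^ 2 + ‖(y : H)‖ ^ 2 := by
    intro y
    have him : (⟪A y, (y : H)⟫_ℂ).im = 0 := by
      have h1 := hsym y y
      have h2 := inner_conj_symm (𝕜 := ℂ) (A y) (y : H)
      rw [← h1] at h2
      exact Complex.conj_eq_iff_im.1 h2
    rw [hT, norm_add_sq (𝕜 := ℂ), inner_smul_right, norm_smul]
    simp [him]
  have hbd : ∀ y : A.domain, ‖(y : H)‖ ≤ ‖T y‖ := by
    intro y
    have := hnorm y
    apply le_of_sq_le_sq _ (norm_nonneg _)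
    nlinarith [sq_nonneg ‖A y‖]
  have hbdA : ∀ y : A.domain, ‖A y‖ ≤ ‖T y‖ := by
    intro y
    have := hnorm y
    apply le_of_sq_le_sq _ (norm_nonneg _)
    nlinarith [sq_nonneg ‖(y : H)‖]
  have hinj : Function.Injective T := by
    rw [← LinearMap.ker_eq_bot, LinearMap.ker_eq_bot']
    intro y hy
    have := hbd y
    rw [hy, norm_zero, norm_le_zero_iff] at this
    exact_mod_cast this
  have hperp : (LinearMap.range T)ᗮ = ⊥ := by
    rw [Submodule.eq_bot_iff]
    intro z hz
    have hz' : ∀ y : A.domain, ⟪Complex.I • z, (y : H)⟫_ℂ = ⟪z, A y⟫_ℂ := by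
      intro y
      have := (Submodule.mem_orthogonal' _ z).1 hz (T y) ⟨y, rfl⟩
      rw [hT, inner_add_right, inner_smul_right] at this
      rw [inner_smul_left, Complex.conj_I]
      linear_combination -this
    have hmem : z ∈ (LinearPMap.adjoint A).domain :=
      LinearPMap.mem_adjoint_domain_of_exists (T := A) z ⟨_, hz'⟩
    have hval : LinearPMap.adjoint A ⟨z, hmem⟩ = Complex.I • z :=
      LinearPMap.adjoint_apply_eq (T := A) hd ⟨z, hmem⟩ hz'
    have hmem' : z ∈ A.domain := by rw [hadj] at hmem; exact hmem
    have hval' : A ⟨z, hmem'⟩ = Complex.I • z := by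
      rw [← hval]
      exact ((LinearPMap.ext_iff.1 hadj).2 (hf := hmem) (hg := hmem')).symm
    have h3 := hsym ⟨z, hmem'⟩ ⟨z, hmem'⟩
    rw [hval', inner_smul_left, inner_smul_right, Complex.conj_I] at h3
    have h4 : ⟪z, z⟫_ℂ = 0 := by
      have : (2 * Complex.I) * ⟪z, z⟫_ℂ = 0 := by linear_combination -h3
      simpa using this
    exact inner_self_eq_zero.1 h4
  have hclosed : IsClosed (LinearMap.range T : Set H) := by
    rw [← isSeqClosed_iff_isClosed]
    intro u a hu hua
    choose y hy using hu
    have hcau : CauchySeq fun n => T (y n) := by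
      have : (fun n => T (y n)) = u := funext hy
      rw [this]; exact hua.cauchySeq
    have hc1 : CauchySeq fun n => ((y n : A.domain) : H) := by
      rw [Metric.cauchySeq_iff] at hcau ⊢
      intro ε hε
      obtain ⟨N, hN⟩ := hcau ε hε
      refine ⟨N, fun m hm n hn => lt_of_le_of_lt ?_ (hN m hm n hn)⟩
      rw [dist_eq_norm, dist_eq_norm, ← map_sub]
      exact hbd (y m - y n)
    have hc2 : CauchySeq fun n => A (y n) := by
      rw [Metric.cauchySeq_iff] at hcau ⊢
      intro ε hε
      obtain ⟨N, hN⟩ := hcau ε hε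
      refine ⟨N, fun m hm n hn => lt_of_le_of_lt ?_ (hN m hm n hn)⟩
      rw [dist_eq_norm, dist_eq_norm, ← LinearPMap.map_sub, ← map_sub]
      exact hbdA (y m - y n)
    obtain ⟨b, hb⟩ := cauchySeq_tendsto_of_complete hc1
    obtain ⟨c, hc⟩ := cauchySeq_tendsto_of_complete hc2
    have hgr : (b, c) ∈ A.graph := by
      have hcl : IsClosed (A.graph : Set (H × H)) := hA.isClosed
      refine hcl.mem_of_tendsto (hb.prodMk_nhds hc) (Filter.Eventually.of_forall fun n => ?_)
      exact LinearPMap.mem_graph A (y n)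
    rw [LinearPMap.mem_graph_iff] at hgr
    obtain ⟨w, hw1, hw2⟩ := hgr
    refine ⟨w, tendsto_nhds_unique ?_ hua⟩
    have : u = fun n => A (y n) + Complex.I • ((y n : A.domain) : H) := funext fun n => (hy n).symm
    rw [this, hT]
    simp only at hw1 hw2
    rw [hw1, hw2]
    exact hc.add (hb.const_smul _)
  have hsurj : LinearMap.range T = ⊤ := by
    have h1 := Submodule.topologicalClosure_eq_top_iff.2 hperp
    rwa [IsClosed.submodule_topologicalClosure_eq hclosed] at h1
  let e : A.domain ≃ₗ[ℂ] H := LinearEquiv.ofBijective T ⟨hinj, LinearMap.range_eq_top.1 hsurj⟩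
  have he : ∀ x, T (e.symm x) = x := fun x => e.apply_symm_apply x
  refine ⟨(A.domain.subtype ∘ₗ (e.symm : H →ₗ[ℂ] A.domain)).mkContinuous 1 ?_, ?_, ?_⟩
  · intro x
    have := hbd (e.symm x)
    rw [he] at this
    simpa using this
  · intro x
    exact ⟨(e.symm x).2, he x⟩
  · intro y
    change ((e.symm (T y) : A.domain) : H) = y
    congr 1
    exact e.symm_apply_apply y

open Classical in
/-- The bounded operator `(A + i)⁻¹`. -/
def resolventI (A : H →ₗ.[ℂ] H) : H →L[ℂ] H :=
  if h : ∃ R, IsResolvent A R then h.choose else 0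

theorem isResolvent_resolventI {A : H →ₗ.[ℂ] H} (hA : IsSelfAdjoint A) :
    IsResolvent A (resolventI A) := by
  have h := exists_isResolvent hA
  rw [resolventI, dif_pos h]
  exact h.choose_spec

open Classical in
/-- The operator `f(A)` for a self-adjoint operator `A` (possibly unbounded) and a continuous
function `f` with compact support in `ℝ`. It is obtained from the continuous functional calculus of
the bounded normal operator `R = (A + i)⁻¹`: as `A = R⁻¹ - i`, the function of `R` to be taken is
`z ↦ f (z⁻¹ - i)`, extended by zero to `z = 0` (the point at infinity of the spectrum of `A`). On
the spectrum of `R` the number `z⁻¹ - i` is real for `z ≠ 0`. -/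
def functionOf (A : H →ₗ.[ℂ] H) (f : ℝ → ℂ) : H →L[ℂ] H :=
  cfc (fun z : ℂ => if z = 0 then 0 else f (z⁻¹ - Complex.I).re) (resolventI A)

/-- The closed orbit of `S` under the self-adjoint operator `A`: the closed span of all `f(A) w`
with `f` continuous of compact support and `w ∈ S`. -/
def orbit (A : H →ₗ.[ℂ] H) (S : Set H) : Submodule ℂ H :=
  (Submodule.span ℂ {x : H | ∃ f : ℝ → ℂ, Continuous f ∧ HasCompactSupport f ∧
    ∃ w ∈ S, x = functionOf A f w}).topologicalClosure

/-- `K` is invariant with respect to `A`. (This includes that `K` is closed.) -/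
def IsInvariant (A : H →ₗ.[ℂ] H) (K : Submodule ℂ H) : Prop :=
  orbit A (K : Set H) = K

/-- A bounded operator has pure point spectrum if its eigenvectors span a dense subspace; for a
self-adjoint operator this says that there is an orthonormal basis of eigenvectors. -/
def HasPurePointSpectrum (T : H →L[ℂ] H) : Prop :=
  (⨆ μ : ℂ, Module.End.eigenspace (T : Module.End ℂ H) μ).topologicalClosure = ⊤

/-- `H` is the orthogonal (Hilbert space) direct sum of the closed subspaces `K α`. -/
structure IsOrthogonalDecomposition {κ : Type*} (K : κ → Submodule ℂ H) : Prop where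
  closed : ∀ α, IsClosed (K α : Set H)
  ortho : ∀ α β, α ≠ β → K α ⟂ K β
  total : (⨆ α, K α).topologicalClosure = ⊤

end Calculus

section System

variable {H₁ H₂ : Type*}
  [NormedAddCommGroup H₁] [InnerProductSpace ℂ H₁] [CompleteSpace H₁]
  [NormedAddCommGroup H₂] [InnerProductSpace ℂ H₂] [CompleteSpace H₂]

/-- The subspace `K₁ ⊕ K₂` of the Hilbert space `H₁ ⊕ H₂`. -/
def directSum (K₁ : Submodule ℂ H₁) (K₂ : Submodule ℂ H₂) : Submodule ℂ (WithLp 2 (H₁ × H₂)) where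
  carrier := {x | x.fst ∈ K₁ ∧ x.snd ∈ K₂}
  add_mem' hx hy := ⟨K₁.add_mem hx.1 hy.1, K₂.add_mem hx.2 hy.2⟩
  zero_mem' := ⟨K₁.zero_mem, K₂.zero_mem⟩
  smul_mem' c _ hx := ⟨K₁.smul_mem c hx.1, K₂.smul_mem c hx.2⟩

/-- The frequency operator `Ω = [[Ω₁, Γ], [Γ†, Ω₂]]` in `H₁ ⊕ H₂`, with domain
`Dom Ω₁ ⊕ Dom Ω₂`. -/
def frequencyOperator (Ω₁ : H₁ →ₗ.[ℂ] H₁) (Ω₂ : H₂ →ₗ.[ℂ] H₂) (Γ : H₂ →L[ℂ] H₁) :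
    WithLp 2 (H₁ × H₂) →ₗ.[ℂ] WithLp 2 (H₁ × H₂) where
  domain := directSum Ω₁.domain Ω₂.domain
  toFun :=
    { toFun := fun x => WithLp.toLp 2
        (Ω₁ ⟨x.1.fst, x.2.1⟩ + Γ x.1.snd, ContinuousLinearMap.adjoint Γ x.1.fst + Ω₂ ⟨x.1.snd, x.2.2⟩)
      map_add' := by
        intro x y
        have h1 : Ω₁ ⟨(x + y).1.fst, (x + y).2.1⟩ =
            Ω₁ ⟨x.1.fst, x.2.1⟩ + Ω₁ ⟨y.1.fst, y.2.1⟩ := by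
          rw [← LinearPMap.map_add]; rfl
        have h2 : Ω₂ ⟨(x + y).1.snd, (x + y).2.2⟩ =
            Ω₂ ⟨x.1.snd, x.2.2⟩ + Ω₂ ⟨y.1.snd, y.2.2⟩ := by
          rw [← LinearPMap.map_add]; rfl
        rw [h1, h2, ← WithLp.toLp_add]
        congr 1
        ext
        · simp only [Submodule.coe_add, WithLp.add_snd, map_add, Prod.fst_add]; abel
        · simp only [Submodule.coe_add, WithLp.add_fst, map_add, Prod.snd_add]; abel
      map_smul' := by
        intro c x
        have h1 : Ω₁ ⟨(c • x).1.fst, (c • x).2.1⟩ = c • Ω₁ ⟨x.1.fst, x.2.1⟩ := by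
          rw [← LinearPMap.map_smul]; rfl
        have h2 : Ω₂ ⟨(c • x).1.snd, (c • x).2.2⟩ = c • Ω₂ ⟨x.1.snd, x.2.2⟩ := by
          rw [← LinearPMap.map_smul]; rfl
        rw [h1, h2, RingHom.id_apply, ← WithLp.toLp_smul]
        congr 1
        ext
        · simp
        · simp }

theorem mem_domain_of_isSelfAdjoint {H : Type*} [NormedAddCommGroup H] [InnerProductSpace ℂ H]
    [CompleteSpace H] {A : H →ₗ.[ℂ] H} (hA : IsSelfAdjoint A) (y w : H)
    (h : ∀ x : A.domain, ⟪w, (x : H)⟫_ℂ = ⟪y, A x⟫_ℂ) : y ∈ A.domain := by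
  have hadj : LinearPMap.adjoint A = A := hA
  have := LinearPMap.mem_adjoint_domain_of_exists (T := A) y ⟨w, h⟩
  rwa [hadj] at this

theorem inner_of_isSelfAdjoint {H : Type*} [NormedAddCommGroup H] [InnerProductSpace ℂ H]
    [CompleteSpace H] {A : H →ₗ.[ℂ] H} (hA : IsSelfAdjoint A) (x y : A.domain) :
    ⟪A x, (y : H)⟫_ℂ = ⟪(x : H), A y⟫_ℂ := by
  have hadj : LinearPMap.adjoint A = A := hA
  have h := LinearPMap.adjoint_isFormalAdjoint (T := A) hA.dense_domain
  rw [hadj] at h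
  exact h x y

/-- The frequency operator is self-adjoint. -/
theorem isSelfAdjoint_frequencyOperator {Ω₁ : H₁ →ₗ.[ℂ] H₁} (h₁ : IsSelfAdjoint Ω₁)
    {Ω₂ : H₂ →ₗ.[ℂ] H₂} (h₂ : IsSelfAdjoint Ω₂) (Γ : H₂ →L[ℂ] H₁) :
    IsSelfAdjoint (frequencyOperator Ω₁ Ω₂ Γ) := by
  set T := frequencyOperator Ω₁ Ω₂ Γ with hT
  have hval : ∀ x : T.domain, T x = WithLp.toLp 2
      (Ω₁ ⟨x.1.fst, x.2.1⟩ + Γ x.1.snd, ContinuousLinearMap.adjoint Γ x.1.fst + Ω₂ ⟨x.1.snd, x.2.2⟩) :=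
    fun x => rfl
  have hd : Dense (T.domain : Set (WithLp 2 (H₁ × H₂))) := by
    have hp := h₁.dense_domain.prod h₂.dense_domain
    exact (hp.preimage (WithLp.prodContinuousLinearEquiv 2 ℂ H₁ H₂).toHomeomorph.isOpenMap)
  have hin : ∀ u v : WithLp 2 (H₁ × H₂), ⟪u, v⟫_ℂ = ⟪u.fst, v.fst⟫_ℂ + ⟪u.snd, v.snd⟫_ℂ :=
    fun u v => rfl
  have hsym : T.IsFormalAdjoint T := by
    intro x y
    have e1 := inner_of_isSelfAdjoint h₁ ⟨x.1.fst, x.2.1⟩ ⟨y.1.fst, y.2.1⟩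
    have e2 := inner_of_isSelfAdjoint h₂ ⟨x.1.snd, x.2.2⟩ ⟨y.1.snd, y.2.2⟩
    rw [hval, hval, hin, hin]
    generalize Ω₁ ⟨x.1.fst, x.2.1⟩ = a1 at *
    generalize Ω₁ ⟨y.1.fst, y.2.1⟩ = b1 at *
    generalize Ω₂ ⟨x.1.snd, x.2.2⟩ = a2 at *
    generalize Ω₂ ⟨y.1.snd, y.2.2⟩ = b2 at *
    change ⟪a1 + Γ x.1.snd, y.1.fst⟫_ℂ + ⟪ContinuousLinearMap.adjoint Γ x.1.fst + a2, y.1.snd⟫_ℂ =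
      ⟪x.1.fst, b1 + Γ y.1.snd⟫_ℂ + ⟪x.1.snd, ContinuousLinearMap.adjoint Γ y.1.fst + b2⟫_ℂ
    simp only [inner_add_left, inner_add_right, ContinuousLinearMap.adjoint_inner_left,
      ContinuousLinearMap.adjoint_inner_right]
    linear_combination e1 + e2
  have hle : T ≤ LinearPMap.adjoint T := LinearPMap.IsFormalAdjoint.le_adjoint hd hsym
  have hdom : (LinearPMap.adjoint T).domain ≤ T.domain := by
    intro y hy
    have key := LinearPMap.adjoint_isFormalAdjoint hd ⟨y, hy⟩
    set z := LinearPMap.adjoint T ⟨y, hy⟩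
    constructor
    · refine mem_domain_of_isSelfAdjoint h₁ y.fst (z.fst - Γ y.snd) fun x => ?_
      have k := key ⟨WithLp.toLp 2 ((x : H₁), (0 : H₂)), x.2, Ω₂.domain.zero_mem⟩
      have h0 : Ω₂ ⟨0, Ω₂.domain.zero_mem⟩ = 0 := Ω₂.map_zero
      rw [hval, hin, hin] at k
      change ⟪z.fst, (x : H₁)⟫_ℂ + ⟪z.snd, (0 : H₂)⟫_ℂ = ⟪y.fst, Ω₁ x + Γ 0⟫_ℂ +
        ⟪y.snd, ContinuousLinearMap.adjoint Γ x + Ω₂ ⟨0, Ω₂.domain.zero_mem⟩⟫_ℂ at k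
      rw [h0, map_zero, add_zero, add_zero, inner_zero_right, add_zero,
        ContinuousLinearMap.adjoint_inner_right] at k
      rw [inner_sub_left, k, add_sub_cancel_right]
    · refine mem_domain_of_isSelfAdjoint h₂ y.snd
        (z.snd - ContinuousLinearMap.adjoint Γ y.fst) fun x => ?_
      have k := key ⟨WithLp.toLp 2 ((0 : H₁), (x : H₂)), Ω₁.domain.zero_mem, x.2⟩
      have h0 : Ω₁ ⟨0, Ω₁.domain.zero_mem⟩ = 0 := Ω₁.map_zero
      rw [hval, hin, hin] at k
      change ⟪z.fst, (0 : H₁)⟫_ℂ + ⟪z.snd, (x : H₂)⟫_ℂ =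
        ⟪y.fst, Ω₁ ⟨0, Ω₁.domain.zero_mem⟩ + Γ x⟫_ℂ +
        ⟪y.snd, ContinuousLinearMap.adjoint Γ 0 + Ω₂ x⟫_ℂ at k
      rw [h0, map_zero, zero_add, zero_add, inner_zero_right, zero_add] at k
      rw [inner_sub_left, k, ContinuousLinearMap.adjoint_inner_left, add_sub_cancel_left]
  exact (LinearPMap.eq_of_le_of_domain_eq hle (le_antisymm hle.1 hdom)).symm

/-- The system is reconstructible: `H₁ ⊕ H₂` is the (state space of the) minimal conservative
extension of each of the two open systems obtained by projecting the dynamics to `H₁` and to `H₂`;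
these minimal extensions are the orbits of `H₁` and of `H₂` under `Ω`. -/
structure IsReconstructible (Ω₁ : H₁ →ₗ.[ℂ] H₁) (Ω₂ : H₂ →ₗ.[ℂ] H₂) (Γ : H₂ →L[ℂ] H₁) : Prop where
  from_first : orbit (frequencyOperator Ω₁ Ω₂ Γ)
    (directSum (⊤ : Submodule ℂ H₁) (⊥ : Submodule ℂ H₂) : Set (WithLp 2 (H₁ × H₂))) = ⊤
  from_second : orbit (frequencyOperator Ω₁ Ω₂ Γ)
    (directSum (⊥ : Submodule ℂ H₁) (⊤ : Submodule ℂ H₂) : Set (WithLp 2 (H₁ × H₂))) = ⊤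

/-- `H₁ ⊕ H₂ = ⨁ α, (K₁ α ⊕ K₂ α)` is an s-invariant decomposition. Zero summands are allowed. -/
structure IsSInvariantDecomposition (Ω₁ : H₁ →ₗ.[ℂ] H₁) (Ω₂ : H₂ →ₗ.[ℂ] H₂) (Γ : H₂ →L[ℂ] H₁)
    {κ : Type*} (K₁ : κ → Submodule ℂ H₁) (K₂ : κ → Submodule ℂ H₂) : Prop where
  decomposition₁ : IsOrthogonalDecomposition K₁
  decomposition₂ : IsOrthogonalDecomposition K₂
  invariant : ∀ α, IsInvariant (frequencyOperator Ω₁ Ω₂ Γ) (directSum (K₁ α) (K₂ α))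

/-- `Γ = ∑ q, √(γ q) |g q⟩⟨g' q|`, convergent in the strong sense, with `γ q > 0` and with
orthonormal families `g` and `g'`. -/
structure IsSingularDecomposition (Γ : H₂ →L[ℂ] H₁) {ι : Type*} (γ : ι → ℝ) (g : ι → H₁)
    (g' : ι → H₂) : Prop where
  pos : ∀ q, 0 < γ q
  orthonormal_left : Orthonormal ℂ g
  orthonormal_right : Orthonormal ℂ g'
  hasSum : ∀ v : H₂, HasSum (fun q => ((Real.sqrt (γ q) : ℂ) * ⟪g' q, v⟫_ℂ) • g q) (Γ v)

/-- The standard representation of `Γ`: `H₀` is identified by unitary maps `U₁` and `U₂` with the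
closures of `Ran Γ` and `Ran Γ†`, where `U₂ U₁⁻¹` is the isometry `U` of the polar decomposition
`Γ† = U (Γ Γ†)^{1/2}`, and `Γ₀ = U₁⁻¹ Γ U₂ = U₂⁻¹ Γ† U₁`. -/
structure IsStandardRepresentation {H₀ : Type*} [NormedAddCommGroup H₀] [InnerProductSpace ℂ H₀]
    [CompleteSpace H₀] (Γ : H₂ →L[ℂ] H₁) (U₁ : H₀ →ₗᵢ[ℂ] H₁) (U₂ : H₀ →ₗᵢ[ℂ] H₂)
    (Γ₀ : H₀ →L[ℂ] H₀) : Prop where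
  range₁ : LinearMap.range U₁.toLinearMap =
    (LinearMap.range (Γ : H₂ →ₗ[ℂ] H₁)).topologicalClosure
  range₂ : LinearMap.range U₂.toLinearMap =
    (LinearMap.range (ContinuousLinearMap.adjoint Γ : H₁ →ₗ[ℂ] H₂)).topologicalClosure
  polar : ∀ (x : H₀) (y : H₁), U₁ x = CFC.sqrt (Γ ∘L ContinuousLinearMap.adjoint Γ) y →
    U₂ x = ContinuousLinearMap.adjoint Γ y
  eq₁ : ∀ x, U₁ (Γ₀ x) = Γ (U₂ x)
  eq₂ : ∀ x, U₂ (Γ₀ x) = ContinuousLinearMap.adjoint Γ (U₁ x)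

/-- The graph of the coupling channels: distinct `p` and `q` are joined if the `Ω₁`-orbit of `g p`
is not orthogonal to `g q` or the `Ω₂`-orbit of `g' p` is not orthogonal to `g' q`. -/
def channelGraph (Ω₁ : H₁ →ₗ.[ℂ] H₁) (Ω₂ : H₂ →ₗ.[ℂ] H₂) {ι : Type*} (g : ι → H₁) (g' : ι → H₂) :
    SimpleGraph ι :=
  SimpleGraph.fromRel fun p q => g q ∉ (orbit Ω₁ {g p})ᗮ ∨ g' q ∉ (orbit Ω₂ {g' p})ᗮ

/-- The orbit `O_A ({g q : q ∈ V})` for the vertex set `V` of each connected component of a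
graph on the index set of `g`. -/
def componentOrbit {H : Type*} [NormedAddCommGroup H] [InnerProductSpace ℂ H] [CompleteSpace H]
    (A : H →ₗ.[ℂ] H) {ι : Type*} (g : ι → H) (G : SimpleGraph ι) (c : G.ConnectedComponent) :
    Submodule ℂ H :=
  orbit A (g '' c.supp)

/-- `D` is a finest s-invariant decomposition: a set of pairs `(K₁, K₂)` of subspaces, not both
zero, such that `H₁ ⊕ H₂` is the s-invariant sum of the `K₁ ⊕ K₂`, and each of these summands lies
in a summand of every given s-invariant decomposition. -/
structure IsFinestDecomposition (Ω₁ : H₁ →ₗ.[ℂ] H₁) (Ω₂ : H₂ →ₗ.[ℂ] H₂) (Γ : H₂ →L[ℂ] H₁)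
    (D : Set (Submodule ℂ H₁ × Submodule ℂ H₂)) : Prop where
  sInvariant : IsSInvariantDecomposition Ω₁ Ω₂ Γ (fun p : D => p.1.1) (fun p : D => p.1.2)
  nonzero : ∀ p ∈ D, p ≠ (⊥, ⊥)
  finest : ∀ E : Set (Submodule ℂ H₁ × Submodule ℂ H₂),
    IsSInvariantDecomposition Ω₁ Ω₂ Γ (fun p : E => p.1.1) (fun p : E => p.1.2) →
    ∀ p ∈ D, ∃ q ∈ E, p.1 ≤ q.1 ∧ p.2 ≤ q.2

end System

end OpenSystem

end

/-!
For a self-adjoint operator `A` and `f ∈ C_c(ℝ)`, the operator `f(A)` is a continuous function of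
the resolvent `(A + i)⁻¹`, which is in turn a norm limit of such `f(A)`. So a closed subspace is
`A`-invariant if and only if the orthogonal projection onto it commutes with the resolvent, that
is, maps the graph of `A` into itself. Read off the graph of `Ω`, this makes `K₁ ⊕ K₂` invariant
under `Ω` if and only if each `Kᵢ` is invariant under `Ωᵢ` and `Γ`, `Γ†` map `K₂`, `K₁` into each
other.

For an s-invariant decomposition, the projections onto the `H_{1α}` therefore commute with `Γ Γ†`,
and since `U₁ Γ₀ = (Γ Γ†)^{1/2} U₁` they induce projections on `H₀` commuting with `Γ₀`. Every
eigenspace of the positive injective operator `Γ₀` is thus an orthogonal sum of its intersections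
with the `U₁⁻¹ H_{1α}`, and bases of these intersections give the adapted decomposition.

Conversely, `O_{Ω₁}({g_q}) ⊕ H₂` is an `Ω`-invariant space containing `H₂`, so it is everything
when the system is reconstructible; hence the component orbits are total, and they are orthogonal
because there are no edges between components. An edge `p q` forces `g_p` and `g_q` into the same
summand of any compatible decomposition. If the nonzero eigenvalues of `Γ Γ†` are simple, each
`g_q` lies in one summand of every s-invariant decomposition, so that every such decomposition is
compatible.
-/

namespace OpenSystem

open scoped InnerProduct

section ReducingPair

variable {𝕜 E F : Type*} [RCLike 𝕜]
  [NormedAddCommGroup E] [InnerProductSpace 𝕜 E] [CompleteSpace E]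
  [NormedAddCommGroup F] [InnerProductSpace 𝕜 F] [CompleteSpace F]

/-- The subspaces `K` and `L` reduce `T : E → F`: `T` maps `K` into `L` and `T†` maps `L` into `K`.
For `E = F` and `K = L` this is the usual notion of a subspace reducing `T`. -/
structure IsReducingPair (T : E →L[𝕜] F) (K : Submodule 𝕜 E) (L : Submodule 𝕜 F) : Prop where
  map_mem : ∀ x ∈ K, T x ∈ L
  adjoint_mem : ∀ y ∈ L, (T†) y ∈ K

namespace IsReducingPair

variable {T : E →L[𝕜] F} {K : Submodule 𝕜 E} {L : Submodule 𝕜 F}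

theorem adjoint (h : IsReducingPair T K L) : IsReducingPair (T†) L K :=
  ⟨h.adjoint_mem, by simpa only [ContinuousLinearMap.adjoint_adjoint] using h.map_mem⟩

theorem orthogonal (h : IsReducingPair T K L) : IsReducingPair T Kᗮ Lᗮ where
  map_mem x hx y hy := by
    rw [← ContinuousLinearMap.adjoint_inner_left]
    exact hx _ (h.adjoint_mem y hy)
  adjoint_mem y hy x hx := by
    rw [ContinuousLinearMap.adjoint_inner_right]
    exact hy _ (h.map_mem x hx)

theorem topologicalClosure (h : IsReducingPair T K L) :
    IsReducingPair T K.topologicalClosure L.topologicalClosure :=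
  ⟨fun _ hx => map_mem_closure T.continuous hx h.map_mem,
    fun _ hy => map_mem_closure (T†).continuous hy h.adjoint_mem⟩

theorem iSup {κ : Type*} {K : κ → Submodule 𝕜 E} {L : κ → Submodule 𝕜 F}
    (h : ∀ i, IsReducingPair T (K i) (L i)) : IsReducingPair T (⨆ i, K i) (⨆ i, L i) where
  map_mem _ hx :=
    iSup_le (a := (⨆ i, L i).comap (T : E →ₗ[𝕜] F))
      (fun i x hx => Submodule.mem_iSup_of_mem i ((h i).map_mem x hx)) hx
  adjoint_mem _ hy :=
    iSup_le (a := (⨆ i, K i).comap (T† : F →ₗ[𝕜] E))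
      (fun i y hy => Submodule.mem_iSup_of_mem i ((h i).adjoint_mem y hy)) hy

theorem comp {G : Type*} [NormedAddCommGroup G] [InnerProductSpace 𝕜 G] [CompleteSpace G]
    {S : F →L[𝕜] G} {M : Submodule 𝕜 G} (hS : IsReducingPair S L M) (hT : IsReducingPair T K L) :
    IsReducingPair (S ∘L T) K M where
  map_mem x hx := hS.map_mem _ (hT.map_mem x hx)
  adjoint_mem z hz := by
    rw [ContinuousLinearMap.adjoint_comp]
    exact hT.adjoint_mem _ (hS.adjoint_mem z hz)

theorem apply_starProjection [K.HasOrthogonalProjection] [L.HasOrthogonalProjection]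
    (h : IsReducingPair T K L) (x : E) : T (K.starProjection x) = L.starProjection (T x) := by
  refine (Submodule.eq_starProjection_of_mem_orthogonal
    (h.map_mem _ (K.starProjection_apply_mem x)) ?_).symm
  rw [← map_sub]
  exact h.orthogonal.map_mem _ (K.sub_starProjection_mem_orthogonal x)

end IsReducingPair

theorem isReducingPair_top (T : E →L[𝕜] F) : IsReducingPair T ⊤ ⊤ :=
  ⟨fun _ _ => trivial, fun _ _ => trivial⟩

theorem isReducingPair_span {T : E →L[𝕜] F} {S : Set E} {S' : Set F}
    (h : ∀ x ∈ S, T x ∈ Submodule.span 𝕜 S') (h' : ∀ y ∈ S', (T†) y ∈ Submodule.span 𝕜 S) :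
    IsReducingPair T (Submodule.span 𝕜 S) (Submodule.span 𝕜 S') where
  map_mem _ hx :=
    (Submodule.span_le (p := (Submodule.span 𝕜 S').comap (T : E →ₗ[𝕜] F))).2 h hx
  adjoint_mem _ hy :=
    (Submodule.span_le (p := (Submodule.span 𝕜 S).comap (T† : F →ₗ[𝕜] E))).2 h' hy

theorem isReducingPair_iff_starProjection {T : E →L[𝕜] F} {K : Submodule 𝕜 E} {L : Submodule 𝕜 F}
    [K.HasOrthogonalProjection] [L.HasOrthogonalProjection] :
    IsReducingPair T K L ↔ T ∘L K.starProjection = L.starProjection ∘L T := by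
  refine ⟨fun h => ContinuousLinearMap.ext h.apply_starProjection, fun h => ?_⟩
  have h' : K.starProjection ∘L T† = T† ∘L L.starProjection := by
    simpa only [ContinuousLinearMap.adjoint_comp, (isSelfAdjoint_starProjection _).adjoint_eq] using
      congrArg ContinuousLinearMap.adjoint h
  refine ⟨fun x hx => ?_, fun y hy => ?_⟩
  · rw [← Submodule.starProjection_eq_self_iff] at hx ⊢
    rw [← ContinuousLinearMap.comp_apply, ← h, ContinuousLinearMap.comp_apply, hx]
  · rw [← Submodule.starProjection_eq_self_iff] at hy ⊢
    rw [← ContinuousLinearMap.comp_apply, h', ContinuousLinearMap.comp_apply, hy]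

theorem isReducingPair_self_iff_commute {T : E →L[𝕜] E} {K : Submodule 𝕜 E}
    [K.HasOrthogonalProjection] : IsReducingPair T K K ↔ Commute T K.starProjection :=
  isReducingPair_iff_starProjection

theorem IsReducingPair.starProjection_mem_eigenspace {T : E →L[𝕜] E} {K : Submodule 𝕜 E}
    [K.HasOrthogonalProjection] (h : IsReducingPair T K K) {μ : 𝕜} {x : E}
    (hx : x ∈ Module.End.eigenspace (T : Module.End 𝕜 E) μ) :
    K.starProjection x ∈ Module.End.eigenspace (T : Module.End 𝕜 E) μ :=
  Module.End.mem_eigenspace_iff.2 ((h.apply_starProjection x).trans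
    ((congrArg _ (Module.End.mem_eigenspace_iff.1 hx)).trans (map_smul _ _ _)))

end ReducingPair

section FunctionalCalculus

variable {H : Type*} [NormedAddCommGroup H] [InnerProductSpace ℂ H] [CompleteSpace H]

theorem IsReducingPair.cfc {T : H →L[ℂ] H} {K : Submodule ℂ H} [K.HasOrthogonalProjection]
    (h : IsReducingPair T K K) (f : ℂ → ℂ) : IsReducingPair (cfc f T) K K :=
  isReducingPair_self_iff_commute.2
    ((isReducingPair_self_iff_commute.1 h).cfc (isReducingPair_self_iff_commute.1 h.adjoint) f)

theorem IsReducingPair.sqrt {T : H →L[ℂ] H} {K : Submodule ℂ H} [K.HasOrthogonalProjection]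
    (h : IsReducingPair T K K) : IsReducingPair (CFC.sqrt T) K K :=
  isReducingPair_self_iff_commute.2 ((isReducingPair_self_iff_commute.1 h).cfcₙ_nnreal _)

end FunctionalCalculus

theorem hasOrthogonalProjection_of_isClosed {𝕜 H : Type*} [RCLike 𝕜] [NormedAddCommGroup H]
    [InnerProductSpace 𝕜 H] [CompleteSpace H] {K : Submodule 𝕜 H} (hK : IsClosed (K : Set H)) :
    K.HasOrthogonalProjection :=
  have := hK.completeSpace_coe
  inferInstance

section Resolvent

variable {H : Type*} [NormedAddCommGroup H] [InnerProductSpace ℂ H] {A : H →ₗ.[ℂ] H} {R : H →L[ℂ] H}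

theorem mem_graph_iff_forall_inner_eq {𝕜 E : Type*} [RCLike 𝕜] [NormedAddCommGroup E]
    [InnerProductSpace 𝕜 E] [CompleteSpace E] {A : E →ₗ.[𝕜] E} (hA : IsSelfAdjoint A) {u v : E} :
    (u, v) ∈ A.graph ↔ ∀ y z, (y, z) ∈ A.graph → ⟪v, y⟫_𝕜 = ⟪u, z⟫_𝕜 := by
  have hgraph : A.graph = A.graph.adjoint := by
    rw [← LinearPMap.adjoint_graph_eq_graph_adjoint hA.dense_domain]
    exact congrArg LinearPMap.graph hA.star_eq.symm
  rw [hgraph, Submodule.mem_adjoint_iff, ← hgraph]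
  refine forall₃_congr fun y z _ => ?_
  rw [sub_eq_zero, ← inner_conj_symm z, ← inner_conj_symm y, (starRingEnd 𝕜).injective.eq_iff,
    eq_comm]

namespace IsResolvent

theorem apply_mem_graph (hR : IsResolvent A R) (x : H) :
    (R x, x - Complex.I • R x) ∈ A.graph := by
  obtain ⟨h, hx⟩ := hR.right x
  exact A.mem_graph_iff.2 ⟨⟨R x, h⟩, rfl, eq_sub_of_add_eq hx⟩

theorem mem_graph_iff (hR : IsResolvent A R) {y z : H} :
    (y, z) ∈ A.graph ↔ R (z + Complex.I • y) = y := by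
  refine ⟨fun h => ?_, fun h => ?_⟩
  · obtain ⟨x, rfl, rfl⟩ := A.mem_graph_iff.1 h
    exact hR.left x
  · simpa only [h, add_sub_cancel_right] using hR.apply_mem_graph (z + Complex.I • y)

theorem injective (hR : IsResolvent A R) : Function.Injective R :=
  (injective_iff_map_eq_zero R).2 fun x hx =>
    A.graph_fst_eq_zero_snd (by simpa [hx] using hR.apply_mem_graph x) rfl

theorem commute_iff (hR : IsResolvent A R) {T : H →L[ℂ] H} :
    Commute R T ↔ ∀ x y, (x, y) ∈ A.graph → (T x, T y) ∈ A.graph := by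
  refine ⟨fun h x y hxy => ?_, fun h => ContinuousLinearMap.ext fun x => ?_⟩
  · rw [hR.mem_graph_iff] at hxy ⊢
    rw [← T.map_smul, ← T.map_add]
    exact (DFunLike.congr_fun h.eq _).trans (congrArg T hxy)
  · have hx := hR.mem_graph_iff.1 (h _ _ (hR.apply_mem_graph x))
    rwa [← T.map_smul, ← T.map_add, sub_add_cancel] at hx

variable [CompleteSpace H]

theorem adjoint_apply_mem_graph (hA : IsSelfAdjoint A) (hR : IsResolvent A R) (x : H) :
    ((R†) x, x + Complex.I • (R†) x) ∈ A.graph := by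
  refine (mem_graph_iff_forall_inner_eq hA).2 fun y z hyz => ?_
  have hx : ⟪(R†) x, z + Complex.I • y⟫_ℂ = ⟪x, y⟫_ℂ := by
    rw [ContinuousLinearMap.adjoint_inner_left, hR.mem_graph_iff.1 hyz]
  rw [inner_add_right, inner_smul_right] at hx
  rw [inner_add_left, inner_smul_left, Complex.conj_I]
  linear_combination -hx

theorem adjoint_apply_eq_of_mem_graph (hA : IsSelfAdjoint A) (hR : IsResolvent A R) {y z : H}
    (hyz : (y, z) ∈ A.graph) : (R†) (z - Complex.I • y) = y := by
  refine ext_inner_right ℂ fun w => ?_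
  have hw := (mem_graph_iff_forall_inner_eq hA).1 hyz _ _ (hR.apply_mem_graph w)
  rw [inner_sub_right, inner_smul_right] at hw
  rw [ContinuousLinearMap.adjoint_inner_left, inner_sub_left, inner_smul_left, Complex.conj_I]
  linear_combination hw

theorem star_eq_add_smul_mul_star (hA : IsSelfAdjoint A) (hR : IsResolvent A R) :
    star R = R + (2 * Complex.I) • (R * star R) := by
  ext x
  have hx := hR.mem_graph_iff.1 (hR.adjoint_apply_mem_graph hA x)
  calc (R†) x = R (x + Complex.I • (R†) x + Complex.I • (R†) x) := hx.symm
    _ = R x + (2 * Complex.I) • R ((R†) x) := by simp only [map_add, map_smul]; module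

theorem star_eq_add_smul_star_mul (hA : IsSelfAdjoint A) (hR : IsResolvent A R) :
    star R = R + (2 * Complex.I) • (star R * R) := by
  ext x
  have hx := hR.adjoint_apply_eq_of_mem_graph hA (hR.apply_mem_graph x)
  calc (R†) x
      = (R†) (x - Complex.I • R x - Complex.I • R x) + (2 * Complex.I) • (R†) (R x) := by
        simp only [map_sub, map_smul]; module
    _ = R x + (2 * Complex.I) • (R†) (R x) := by rw [hx]

theorem isStarNormal (hA : IsSelfAdjoint A) (hR : IsResolvent A R) : IsStarNormal R :=
  ⟨smul_right_injective _ (mul_ne_zero two_ne_zero Complex.I_ne_zero) (add_left_cancel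
    ((hR.star_eq_add_smul_star_mul hA).symm.trans (hR.star_eq_add_smul_mul_star hA)))⟩

theorem conj_eq_of_mem_spectrum (hA : IsSelfAdjoint A) (hR : IsResolvent A R) {z : ℂ}
    (hz : z ∈ spectrum ℂ R) : conj z = z + 2 * Complex.I * (z * conj z) := by
  have := hR.isStarNormal hA
  have hcfc : cfc (fun z : ℂ => star z) R =
      cfc (fun z : ℂ => z + (2 * Complex.I) • (z * star z)) R := by
    rw [cfc_add R (fun z : ℂ => z) (fun z : ℂ => (2 * Complex.I) • (z * star z)),
      cfc_smul (2 * Complex.I) (fun z : ℂ => z * star z) R,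
      cfc_mul (fun z : ℂ => z) (fun z : ℂ => star z) R, cfc_star_id (R := ℂ) R, cfc_id' ℂ R]
    exact hR.star_eq_add_smul_mul_star hA
  exact eqOn_of_cfc_eq_cfc (R := ℂ) hcfc (by fun_prop) (by fun_prop) inferInstance hz

theorem exists_real_mul_add_I_eq_one (hA : IsSelfAdjoint A) (hR : IsResolvent A R) {z : ℂ}
    (hz : z ∈ spectrum ℂ R) (h0 : z ≠ 0) : ∃ t : ℝ, z * (t + Complex.I) = 1 := by
  have h0' : conj z ≠ 0 := (map_ne_zero _).2 h0
  have hreal : conj (z⁻¹ - Complex.I) = z⁻¹ - Complex.I := by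
    rw [map_sub, map_inv₀, Complex.conj_I]
    field_simp
    linear_combination -hR.conj_eq_of_mem_spectrum hA hz
  refine ⟨(z⁻¹ - Complex.I).re, ?_⟩
  rw [Complex.conj_eq_iff_re.1 hreal, sub_add_cancel, mul_inv_cancel₀ h0]

end IsResolvent

end Resolvent

section Calculus

variable {H : Type*} [NormedAddCommGroup H] [InnerProductSpace ℂ H] [CompleteSpace H]
  {A : H →ₗ.[ℂ] H}

open Classical in
/-- The function of `(A + i)⁻¹` that represents `f(A)`: as `t ↦ (t + i)⁻¹` has the inverse
`z ↦ z⁻¹ - i`, it is `z ↦ f (z⁻¹ - i)`, with the value `0` at the point `z = 0` that corresponds to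
`t = ∞`. -/
noncomputable def resolventSymbol (f : ℝ → ℂ) (z : ℂ) : ℂ :=
  if z = 0 then 0 else f (z⁻¹ - Complex.I).re

theorem resolventSymbol_zero (f : ℝ → ℂ) : resolventSymbol f 0 = 0 := if_pos rfl

theorem resolventSymbol_of_mul_add_I_eq_one (f : ℝ → ℂ) {z : ℂ} {t : ℝ}
    (h : z * (t + Complex.I) = 1) : resolventSymbol f z = f t := by
  rw [resolventSymbol, if_neg (left_ne_zero_of_mul_eq_one h), inv_eq_of_mul_eq_one_right h,
    add_sub_cancel_right, Complex.ofReal_re]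

theorem functionOf_eq_cfc (A : H →ₗ.[ℂ] H) (f : ℝ → ℂ) :
    functionOf A f = cfc (resolventSymbol f) (resolventI A) :=
  rfl

theorem norm_add_I_mul_norm_eq_one {z : ℂ} {t : ℝ} (h : z * (t + Complex.I) = 1) :
    ‖z‖ * ‖(t : ℂ) + Complex.I‖ = 1 := by
  rw [← norm_mul, h, norm_one]

theorem abs_mul_norm_le_one {z : ℂ} {t : ℝ} (h : z * (t + Complex.I) = 1) : |t| * ‖z‖ ≤ 1 := by
  have ht : |t| ≤ ‖(t : ℂ) + Complex.I‖ := by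
    simpa using Complex.abs_re_le_norm ((t : ℂ) + Complex.I)
  calc |t| * ‖z‖ ≤ ‖(t : ℂ) + Complex.I‖ * ‖z‖ := by gcongr
    _ = 1 := by rw [mul_comm, norm_add_I_mul_norm_eq_one h]

theorem continuous_inv_add_I : Continuous fun t : ℝ => ((t : ℂ) + Complex.I)⁻¹ :=
  Continuous.inv₀ (by fun_prop) fun t h => by simpa using congrArg Complex.im h

theorem exists_mul_add_I_eq_one_of_mem_spectrum (hA : IsSelfAdjoint A) {z : ℂ}
    (hz : z ∈ spectrum ℂ (resolventI A)) (h0 : z ≠ 0) : ∃ t : ℝ, z * (t + Complex.I) = 1 :=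
  (isResolvent_resolventI hA).exists_real_mul_add_I_eq_one hA hz h0

theorem continuousAt_resolventSymbol {f : ℝ → ℂ} (hf : Continuous f) {z : ℂ} (h0 : z ≠ 0) :
    ContinuousAt (resolventSymbol f) z := by
  have hcomp : ContinuousAt (fun z : ℂ => f (z⁻¹ - Complex.I).re) z :=
    hf.continuousAt.comp (Complex.continuous_re.continuousAt.comp
      ((continuousAt_inv₀ h0).sub continuousAt_const))
  refine hcomp.congr ?_
  filter_upwards [isOpen_ne.mem_nhds h0] with w hw
  rw [resolventSymbol, if_neg hw]

theorem exists_resolventSymbol_eq_zero {f : ℝ → ℂ} (hc : HasCompactSupport f) :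
    ∃ r > 0, ∀ (z : ℂ) (t : ℝ), z * (t + Complex.I) = 1 → ‖z‖ < r → resolventSymbol f z = 0 := by
  obtain ⟨C, hC, hfC⟩ := hc.isCompact.isBounded.exists_pos_norm_le
  refine ⟨(C + 1)⁻¹, by positivity, fun z t h hz => ?_⟩
  rw [resolventSymbol_of_mul_add_I_eq_one f h]
  refine image_eq_zero_of_notMem_tsupport fun ht => ?_
  have hle : ‖(t : ℂ) + Complex.I‖ ≤ C + 1 :=
    (norm_add_le _ _).trans (by simpa using hfC t ht)
  have hlt : ‖z‖ * ‖(t : ℂ) + Complex.I‖ < 1 := by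
    calc ‖z‖ * ‖(t : ℂ) + Complex.I‖ ≤ ‖z‖ * (C + 1) := by gcongr
      _ < 1 := by rwa [← lt_div_iff₀ (by positivity), one_div]
  exact hlt.ne (norm_add_I_mul_norm_eq_one h)

theorem continuousOn_resolventSymbol (hA : IsSelfAdjoint A) {f : ℝ → ℂ} (hf : Continuous f)
    (hc : HasCompactSupport f) :
    ContinuousOn (resolventSymbol f) (spectrum ℂ (resolventI A)) := by
  intro z _
  rcases eq_or_ne z 0 with rfl | h0
  · obtain ⟨r, hr, hfr⟩ := exists_resolventSymbol_eq_zero hc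
    refine (continuousWithinAt_const (b := (0 : ℂ))).congr_of_eventuallyEq ?_
      (resolventSymbol_zero f)
    filter_upwards [mem_nhdsWithin_of_mem_nhds (Metric.ball_mem_nhds (0 : ℂ) hr),
      self_mem_nhdsWithin] with w hw hws
    rcases eq_or_ne w 0 with rfl | hw0
    · exact resolventSymbol_zero f
    · obtain ⟨t, ht⟩ := exists_mul_add_I_eq_one_of_mem_spectrum hA hws hw0
      exact hfr w t ht (mem_ball_zero_iff.1 hw)
  · exact (continuousAt_resolventSymbol hf h0).continuousWithinAt

theorem cfc_mul_functionOf (hA : IsSelfAdjoint A) {r : ℂ → ℂ} (hr : Continuous r) {h : ℝ → ℂ}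
    (hrh : ∀ (z : ℂ) (t : ℝ), z * (t + Complex.I) = 1 → r z = h t)
    {f : ℝ → ℂ} (hf : Continuous f) (hc : HasCompactSupport f) :
    cfc r (resolventI A) * functionOf A f = functionOf A (h * f) := by
  rw [functionOf_eq_cfc, functionOf_eq_cfc, ← cfc_mul r (resolventSymbol f) (resolventI A)
    hr.continuousOn (continuousOn_resolventSymbol hA hf hc)]
  refine cfc_congr fun z hz => ?_
  rcases eq_or_ne z 0 with rfl | h0
  · simp only [resolventSymbol_zero, mul_zero]
  · obtain ⟨t, ht⟩ := exists_mul_add_I_eq_one_of_mem_spectrum hA hz h0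
    simp only [resolventSymbol_of_mul_add_I_eq_one _ ht, hrh z t ht, Pi.mul_apply]

/-- A piecewise linear function supported in `[-ε⁻¹, ε⁻¹]`, which tends to `1` as `ε → 0`. -/
noncomputable def tent (ε t : ℝ) : ℝ := max 0 (1 - ε * |t|)

theorem continuous_tent (ε : ℝ) : Continuous (tent ε) := by
  unfold tent
  fun_prop

theorem hasCompactSupport_tent {ε : ℝ} (hε : 0 < ε) : HasCompactSupport (tent ε) := by
  refine HasCompactSupport.intro (isCompact_closedBall (0 : ℝ) ε⁻¹) fun t ht => max_eq_left ?_
  rw [mem_closedBall_zero_iff, not_le, Real.norm_eq_abs, inv_lt_iff_one_lt_mul₀ hε] at ht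
  linarith

theorem abs_one_sub_tent_le {ε : ℝ} (hε : 0 ≤ ε) (t : ℝ) : |1 - tent ε t| ≤ ε * |t| := by
  have hεt : 0 ≤ ε * |t| := by positivity
  have hle : tent ε t ≤ 1 := max_le zero_le_one (by linarith)
  rw [abs_of_nonneg (by linarith)]
  linarith [show 1 - ε * |t| ≤ tent ε t from le_max_right _ _]

theorem exists_norm_resolventI_sub_functionOf_le (hA : IsSelfAdjoint A) {ε : ℝ} (hε : 0 < ε) :
    ∃ f : ℝ → ℂ, Continuous f ∧ HasCompactSupport f ∧ ‖resolventI A - functionOf A f‖ ≤ ε := by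
  have hn := (isResolvent_resolventI hA).isStarNormal hA
  have hf : Continuous fun t : ℝ => (tent ε t : ℂ) * ((t : ℂ) + Complex.I)⁻¹ :=
    (Complex.continuous_ofReal.comp (continuous_tent ε)).mul continuous_inv_add_I
  have hc : HasCompactSupport fun t : ℝ => (tent ε t : ℂ) * ((t : ℂ) + Complex.I)⁻¹ :=
    ((hasCompactSupport_tent hε).comp_left Complex.ofReal_zero).mul_right
  refine ⟨_, hf, hc, ?_⟩
  rw [functionOf_eq_cfc]
  nth_rw 1 [← cfc_id' ℂ (resolventI A)]
  rw [← cfc_sub (fun z : ℂ => z) _ (resolventI A) (by fun_prop)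
    (continuousOn_resolventSymbol hA hf hc)]
  refine norm_cfc_le hε.le fun z hz => ?_
  rcases eq_or_ne z 0 with rfl | h0
  · simpa only [resolventSymbol_zero, sub_zero, norm_zero] using hε.le
  obtain ⟨t, ht⟩ := exists_mul_add_I_eq_one_of_mem_spectrum hA hz h0
  rw [resolventSymbol_of_mul_add_I_eq_one _ ht, ← eq_inv_of_mul_eq_one_left ht]
  calc ‖z - tent ε t * z‖ = |1 - tent ε t| * ‖z‖ := by
        rw [← Real.norm_eq_abs, ← Complex.norm_real, ← norm_mul]
        push_cast
        ring_nf
    _ ≤ ε * |t| * ‖z‖ := by gcongr; exact abs_one_sub_tent_le hε.le t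
    _ = ε * (|t| * ‖z‖) := mul_assoc _ _ _
    _ ≤ ε := mul_le_of_le_one_right hε.le (abs_mul_norm_le_one ht)

end Calculus

section Orbit

variable {H : Type*} [NormedAddCommGroup H] [InnerProductSpace ℂ H] [CompleteSpace H]
  {A : H →ₗ.[ℂ] H} {K : Submodule ℂ H} {S T : Set H}

theorem isClosed_orbit (A : H →ₗ.[ℂ] H) (S : Set H) : IsClosed (orbit A S : Set H) :=
  Submodule.isClosed_topologicalClosure _

theorem functionOf_apply_mem_orbit {f : ℝ → ℂ} (hf : Continuous f) (hc : HasCompactSupport f)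
    {w : H} (hw : w ∈ S) : functionOf A f w ∈ orbit A S :=
  Submodule.le_topologicalClosure _ (Submodule.subset_span ⟨f, hf, hc, w, hw, rfl⟩)

theorem isReducingPair_orbit (hA : IsSelfAdjoint A) (S : Set H) :
    IsReducingPair (resolventI A) (orbit A S) (orbit A S) := by
  have hn := (isResolvent_resolventI hA).isStarNormal hA
  refine (isReducingPair_span ?_ ?_).topologicalClosure
  · rintro _ ⟨f, hf, hc, w, hw, rfl⟩
    refine Submodule.subset_span ⟨_, continuous_inv_add_I.mul hf, hc.mul_left, w, hw, ?_⟩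
    have hmul := cfc_mul_functionOf hA continuous_id
      (fun _ _ ht => eq_inv_of_mul_eq_one_left ht) hf hc
    rw [cfc_id ℂ (resolventI A)] at hmul
    exact DFunLike.congr_fun hmul w
  · rintro _ ⟨f, hf, hc, w, hw, rfl⟩
    refine Submodule.subset_span
      ⟨_, (continuous_star.comp continuous_inv_add_I).mul hf, hc.mul_left, w, hw, ?_⟩
    have hmul := cfc_mul_functionOf hA continuous_star
      (fun _ _ ht => congrArg star (eq_inv_of_mul_eq_one_left ht)) hf hc
    rw [cfc_star_id (R := ℂ) (resolventI A)] at hmul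
    exact DFunLike.congr_fun hmul w

theorem IsReducingPair.functionOf [K.HasOrthogonalProjection]
    (h : IsReducingPair (resolventI A) K K) (f : ℝ → ℂ) : IsReducingPair (functionOf A f) K K :=
  h.cfc _

theorem IsReducingPair.orbit_le (h : IsReducingPair (resolventI A) K K)
    (hK : IsClosed (K : Set H)) (hS : S ⊆ K) : orbit A S ≤ K := by
  have := hasOrthogonalProjection_of_isClosed hK
  refine Submodule.topologicalClosure_minimal _ (Submodule.span_le.2 ?_) hK
  rintro _ ⟨f, -, -, w, hw, rfl⟩
  exact (h.functionOf f).map_mem w (hS hw)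

theorem eq_zero_of_forall_functionOf_apply_eq_zero (hA : IsSelfAdjoint A) {u : H}
    (h : ∀ f : ℝ → ℂ, Continuous f → HasCompactSupport f → functionOf A f u = 0) : u = 0 := by
  suffices hu : resolventI A u = 0 from
    (isResolvent_resolventI hA).injective (hu.trans (map_zero _).symm)
  refine norm_le_zero_iff.1 (le_of_forall_pos_le_add fun ε hε => ?_)
  obtain ⟨f, hf, hc, hfε⟩ := exists_norm_resolventI_sub_functionOf_le hA
    (show 0 < ε / (‖u‖ + 1) by positivity)
  calc ‖resolventI A u‖ = ‖(resolventI A - functionOf A f) u‖ := by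
        rw [sub_apply, h f hf hc, sub_zero]
    _ ≤ ε / (‖u‖ + 1) * ‖u‖ := ContinuousLinearMap.le_of_opNorm_le _ hfε u
    _ ≤ ε / (‖u‖ + 1) * (‖u‖ + 1) := by gcongr; linarith
    _ = 0 + ε := by field_simp; ring

/- The component `u` of `w ∈ S` orthogonal to the orbit satisfies `f(A) u = 0` for all `f`, because
`f(A) w` lies in the orbit and the orbit reduces `f(A)`. -/
theorem subset_orbit (hA : IsSelfAdjoint A) (S : Set H) : S ⊆ orbit A S := by
  intro w hw
  have := hasOrthogonalProjection_of_isClosed (isClosed_orbit A S)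
  rw [SetLike.mem_coe, ← Submodule.starProjection_eq_self_iff, eq_comm, ← sub_eq_zero]
  refine eq_zero_of_forall_functionOf_apply_eq_zero hA fun f hf hc => ?_
  have hred := (isReducingPair_orbit hA S).functionOf f
  refine Submodule.disjoint_def.1 (orbit A S).orthogonal_disjoint _ ?_
    (hred.orthogonal.map_mem _ ((orbit A S).sub_starProjection_mem_orthogonal w))
  rw [map_sub]
  exact Submodule.sub_mem _ (functionOf_apply_mem_orbit hf hc hw)
    (hred.map_mem _ ((orbit A S).starProjection_apply_mem w))

theorem isInvariant_iff (hA : IsSelfAdjoint A) :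
    IsInvariant A K ↔ IsClosed (K : Set H) ∧ IsReducingPair (resolventI A) K K := by
  refine ⟨fun h => ?_, fun ⟨hK, h⟩ =>
    le_antisymm (h.orbit_le hK subset_rfl) (subset_orbit hA _)⟩
  rw [← show orbit A K = K from h]
  exact ⟨isClosed_orbit _ _, isReducingPair_orbit hA _⟩

theorem isInvariant_iff_starProjection_mem_graph (hA : IsSelfAdjoint A)
    [K.HasOrthogonalProjection] : IsInvariant A K ↔
      ∀ x y, (x, y) ∈ A.graph → (K.starProjection x, K.starProjection y) ∈ A.graph := by
  rw [isInvariant_iff hA, ← (isResolvent_resolventI hA).commute_iff,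
    isReducingPair_self_iff_commute]
  exact and_iff_right (K.orthogonal_orthogonal ▸ Kᗮ.isClosed_orthogonal)

theorem isInvariant_orbit (hA : IsSelfAdjoint A) (S : Set H) : IsInvariant A (orbit A S) :=
  (isInvariant_iff hA).2 ⟨isClosed_orbit A S, isReducingPair_orbit hA S⟩

theorem isInvariant_top (hA : IsSelfAdjoint A) : IsInvariant A (⊤ : Submodule ℂ H) :=
  (isInvariant_iff hA).2 ⟨isClosed_univ, isReducingPair_top _⟩

theorem IsInvariant.orbit_le (hA : IsSelfAdjoint A) (h : IsInvariant A K) (hS : S ⊆ K) :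
    orbit A S ≤ K :=
  have hK := (isInvariant_iff hA).1 h
  hK.2.orbit_le hK.1 hS

theorem orbit_isOrtho (hA : IsSelfAdjoint A) (h : ∀ x ∈ S, x ∈ (orbit A T)ᗮ) :
    orbit A S ⟂ orbit A T :=
  (isReducingPair_orbit hA T).orthogonal.orbit_le (Submodule.isClosed_orthogonal _) h

end Orbit

section System

variable {H₁ H₂ : Type*}
  [NormedAddCommGroup H₁] [InnerProductSpace ℂ H₁]
  [NormedAddCommGroup H₂] [InnerProductSpace ℂ H₂]
  {K₁ : Submodule ℂ H₁} {K₂ : Submodule ℂ H₂}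

theorem isClosed_directSum (h₁ : IsClosed (K₁ : Set H₁)) (h₂ : IsClosed (K₂ : Set H₂)) :
    IsClosed (directSum K₁ K₂ : Set (WithLp 2 (H₁ × H₂))) :=
  (h₁.preimage (WithLp.fstL 2 ℂ H₁ H₂).continuous).inter
    (h₂.preimage (WithLp.sndL 2 ℂ H₁ H₂).continuous)

theorem starProjection_directSum [K₁.HasOrthogonalProjection] [K₂.HasOrthogonalProjection]
    [(directSum K₁ K₂).HasOrthogonalProjection] (x : WithLp 2 (H₁ × H₂)) :
    (directSum K₁ K₂).starProjection x =
      WithLp.toLp 2 (K₁.starProjection x.fst, K₂.starProjection x.snd) := by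
  refine Submodule.eq_starProjection_of_mem_orthogonal
    ⟨K₁.starProjection_apply_mem _, K₂.starProjection_apply_mem _⟩ fun u hu => ?_
  rw [WithLp.prod_inner_apply]
  exact (congrArg₂ (· + ·) (K₁.sub_starProjection_mem_orthogonal x.fst _ hu.1)
    (K₂.sub_starProjection_mem_orthogonal x.snd _ hu.2)).trans (add_zero 0)

variable [CompleteSpace H₁] [CompleteSpace H₂]
  {Ω₁ : H₁ →ₗ.[ℂ] H₁} {Ω₂ : H₂ →ₗ.[ℂ] H₂} {Γ : H₂ →L[ℂ] H₁}

theorem mem_graph_frequencyOperator {x y : WithLp 2 (H₁ × H₂)} :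
    (x, y) ∈ (frequencyOperator Ω₁ Ω₂ Γ).graph ↔
      (x.fst, y.fst - Γ x.snd) ∈ Ω₁.graph ∧ (x.snd, y.snd - (Γ†) x.fst) ∈ Ω₂.graph := by
  simp only [LinearPMap.mem_graph_iff]
  constructor
  · rintro ⟨x, rfl, rfl⟩
    exact ⟨⟨⟨_, x.2.1⟩, rfl, (add_sub_cancel_right _ _).symm⟩,
      ⟨_, x.2.2⟩, rfl, (add_sub_cancel_left _ _).symm⟩
  · rintro ⟨⟨⟨_, hx₁⟩, rfl, h₁⟩, ⟨_, hx₂⟩, rfl, h₂⟩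
    refine ⟨⟨x, hx₁, hx₂⟩, rfl, WithLp.ofLp_injective 2 (Prod.ext ?_ ?_)⟩
    · exact eq_sub_iff_add_eq.1 h₁
    · exact (add_comm _ _).trans (eq_sub_iff_add_eq.1 h₂)

theorem inl_mem_graph_frequencyOperator {x y : H₁} (h : (x, y) ∈ Ω₁.graph) :
    (WithLp.toLp 2 (x, (0 : H₂)), WithLp.toLp 2 (y, (Γ†) x)) ∈ (frequencyOperator Ω₁ Ω₂ Γ).graph :=
  mem_graph_frequencyOperator.2 ⟨by simpa using h, by simp⟩

theorem inr_mem_graph_frequencyOperator {x y : H₂} (h : (x, y) ∈ Ω₂.graph) :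
    (WithLp.toLp 2 ((0 : H₁), x), WithLp.toLp 2 (Γ x, y)) ∈ (frequencyOperator Ω₁ Ω₂ Γ).graph :=
  mem_graph_frequencyOperator.2 ⟨by simp, by simpa using h⟩

theorem isInvariant_directSum_iff (h₁ : IsSelfAdjoint Ω₁) (h₂ : IsSelfAdjoint Ω₂)
    [K₁.HasOrthogonalProjection] [K₂.HasOrthogonalProjection] :
    IsInvariant (frequencyOperator Ω₁ Ω₂ Γ) (directSum K₁ K₂) ↔
      IsInvariant Ω₁ K₁ ∧ IsInvariant Ω₂ K₂ ∧ IsReducingPair Γ K₂ K₁ := by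
  have := hasOrthogonalProjection_of_isClosed (isClosed_directSum
    (K₁.orthogonal_orthogonal ▸ K₁ᗮ.isClosed_orthogonal)
    (K₂.orthogonal_orthogonal ▸ K₂ᗮ.isClosed_orthogonal))
  rw [isInvariant_iff_starProjection_mem_graph (isSelfAdjoint_frequencyOperator h₁ h₂ Γ),
    isInvariant_iff_starProjection_mem_graph h₁, isInvariant_iff_starProjection_mem_graph h₂]
  simp only [starProjection_directSum]
  refine ⟨fun h => ⟨fun x y hxy => ?_, fun x y hxy => ?_, ?_⟩, fun ⟨hK₁, hK₂, hΓ⟩ x y hxy => ?_⟩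
  · simpa using (mem_graph_frequencyOperator.1
      (h _ _ (inl_mem_graph_frequencyOperator (Ω₂ := Ω₂) (Γ := Γ) hxy))).1
  · simpa using (mem_graph_frequencyOperator.1
      (h _ _ (inr_mem_graph_frequencyOperator (Ω₁ := Ω₁) (Γ := Γ) hxy))).2
  · rw [isReducingPair_iff_starProjection]
    refine ContinuousLinearMap.ext_on (h₂.dense_domain.mono Submodule.subset_span) fun x hx => ?_
    have hgraph := (mem_graph_frequencyOperator.1 (h _ _
      (inr_mem_graph_frequencyOperator (Ω₁ := Ω₁) (Γ := Γ) (Ω₂.mem_graph ⟨x, hx⟩)))).1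
    exact (sub_eq_zero.1 (Ω₁.graph_fst_eq_zero_snd hgraph (map_zero _))).symm
  · obtain ⟨hx₁, hx₂⟩ := mem_graph_frequencyOperator.1 hxy
    have hP₁ := hK₁ _ _ hx₁
    have hP₂ := hK₂ _ _ hx₂
    rw [map_sub, ← hΓ.apply_starProjection] at hP₁
    rw [map_sub, ← hΓ.adjoint.apply_starProjection] at hP₂
    exact mem_graph_frequencyOperator.2 ⟨hP₁, hP₂⟩

theorem orbit_frequencyOperator_le (h₁ : IsSelfAdjoint Ω₁) (h₂ : IsSelfAdjoint Ω₂)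
    (hK₁ : IsInvariant Ω₁ K₁) (hK₂ : IsInvariant Ω₂ K₂) (hΓ : IsReducingPair Γ K₂ K₁)
    {S : Set (WithLp 2 (H₁ × H₂))} (hS : S ⊆ directSum K₁ K₂) :
    orbit (frequencyOperator Ω₁ Ω₂ Γ) S ≤ directSum K₁ K₂ :=
  have := hasOrthogonalProjection_of_isClosed ((isInvariant_iff h₁).1 hK₁).1
  have := hasOrthogonalProjection_of_isClosed ((isInvariant_iff h₂).1 hK₂).1
  ((isInvariant_directSum_iff h₁ h₂).2 ⟨hK₁, hK₂, hΓ⟩).orbit_le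
    (isSelfAdjoint_frequencyOperator h₁ h₂ Γ) hS

namespace IsSInvariantDecomposition

variable {κ : Type*} {K₁ : κ → Submodule ℂ H₁} {K₂ : κ → Submodule ℂ H₂}

theorem isInvariant_and_isReducingPair (h : IsSInvariantDecomposition Ω₁ Ω₂ Γ K₁ K₂)
    (h₁ : IsSelfAdjoint Ω₁) (h₂ : IsSelfAdjoint Ω₂) (α : κ) :
    IsInvariant Ω₁ (K₁ α) ∧ IsInvariant Ω₂ (K₂ α) ∧ IsReducingPair Γ (K₂ α) (K₁ α) :=
  have := hasOrthogonalProjection_of_isClosed (h.decomposition₁.closed α)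
  have := hasOrthogonalProjection_of_isClosed (h.decomposition₂.closed α)
  (isInvariant_directSum_iff h₁ h₂).1 (h.invariant α)

end IsSInvariantDecomposition

end System

section OrthogonalDecomposition

universe u

variable {H : Type u} [NormedAddCommGroup H] [InnerProductSpace ℂ H]

theorem topologicalClosure_iSup_eq_top_iff [CompleteSpace H] {κ : Type*} {K : κ → Submodule ℂ H} :
    (⨆ α, K α).topologicalClosure = ⊤ ↔ ∀ x, (∀ α, x ∈ (K α)ᗮ) → x = 0 := by
  simp only [Submodule.topologicalClosure_eq_top_iff, ← Submodule.iInf_orthogonal,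
    Submodule.eq_bot_iff, Submodule.mem_iInf]

theorem isOrthogonalDecomposition_top :
    IsOrthogonalDecomposition fun _ : Unit => (⊤ : Submodule ℂ H) :=
  ⟨fun _ => isClosed_univ, fun _ _ h => (h rfl).elim, by
    rw [iSup_const]; exact isClosed_univ.submodule_topologicalClosure_eq⟩

theorem isOrthogonalDecomposition_eigenspace {T : H →L[ℂ] H}
    (hT : (T : H →ₗ[ℂ] H).IsSymmetric) (hpp : HasPurePointSpectrum T) :
    IsOrthogonalDecomposition (Module.End.eigenspace (T : Module.End ℂ H)) where
  closed μ := by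
    convert isClosed_eq T.continuous (continuous_const_smul μ) using 1
    exact Set.ext fun x => Module.End.mem_eigenspace_iff
  ortho μ ν h := hT.orthogonalFamily_eigenspaces.isOrtho h
  total := hpp

theorem mem_orthogonal_of_inner_starProjection_eq_zero {𝕜 E : Type*} [RCLike 𝕜]
    [NormedAddCommGroup E] [InnerProductSpace 𝕜 E] {K : Submodule 𝕜 E}
    [K.HasOrthogonalProjection] {x : E} (hx : ⟪K.starProjection x, x⟫_𝕜 = 0) : x ∈ Kᗮ := by
  rw [← K.starProjection_apply_eq_zero_iff, ← inner_self_eq_zero (𝕜 := 𝕜),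
    ← K.inner_starProjection_left_eq_right,
    K.starProjection_eq_self_iff.2 (K.starProjection_apply_mem x), hx]

namespace IsOrthogonalDecomposition

variable {κ : Type*} {K : κ → Submodule ℂ H}

theorem of_comp_surjective {κ' : Type*} {f : κ' → κ} (hf : Function.Surjective f)
    (h : IsOrthogonalDecomposition fun α => K (f α)) : IsOrthogonalDecomposition K where
  closed := hf.forall.2 h.closed
  ortho := hf.forall₂.2 fun α β hne => h.ortho α β fun e => hne (congrArg f e)
  total := by rw [← hf.iSup_comp]; exact h.total

variable [CompleteSpace H] (h : IsOrthogonalDecomposition K)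
include h

theorem hasOrthogonalProjection (α : κ) : (K α).HasOrthogonalProjection :=
  hasOrthogonalProjection_of_isClosed (h.closed α)

theorem eq_zero_of_forall_mem_orthogonal {x : H} (hx : ∀ α, x ∈ (K α)ᗮ) : x = 0 :=
  topologicalClosure_iSup_eq_top_iff.1 h.total x hx

theorem mem_of_forall_ne_mem_orthogonal {x : H} {α : κ} (hx : ∀ β ≠ α, x ∈ (K β)ᗮ) : x ∈ K α := by
  have := h.hasOrthogonalProjection α
  rw [← Submodule.starProjection_eq_self_iff, eq_comm, ← sub_eq_zero]
  refine h.eq_zero_of_forall_mem_orthogonal fun β => ?_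
  obtain rfl | hne := eq_or_ne β α
  · exact Submodule.sub_starProjection_mem_orthogonal x
  · exact Submodule.sub_mem _ (hx β hne)
      (h.ortho α β hne.symm ((K α).starProjection_apply_mem x))

theorem comap [∀ α, (K α).HasOrthogonalProjection] {H₀ : Type*} [NormedAddCommGroup H₀]
    [InnerProductSpace ℂ H₀] [CompleteSpace H₀] (U : H₀ →ₗᵢ[ℂ] H)
    (hU : ∀ α x, (K α).starProjection (U x) ∈ LinearMap.range U.toLinearMap) :
    IsOrthogonalDecomposition fun α => (K α).comap U.toLinearMap where
  closed α := (h.closed α).preimage U.continuous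
  ortho α β hne x hx y hy := by
    rw [← U.inner_map_map]
    exact h.ortho α β hne hx _ hy
  total := topologicalClosure_iSup_eq_top_iff.2 fun x hx => by
    refine U.injective ((h.eq_zero_of_forall_mem_orthogonal fun α => ?_).trans U.map_zero.symm)
    obtain ⟨y, hy : U y = _⟩ := hU α x
    have hyK : U y ∈ K α := hy ▸ (K α).starProjection_apply_mem _
    refine mem_orthogonal_of_inner_starProjection_eq_zero ?_
    rw [← hy, U.inner_map_map, hx α y hyK]

theorem inf {ν : Type*} {L : ν → Submodule ℂ H} (hL : IsOrthogonalDecomposition L)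
    [∀ α, (K α).HasOrthogonalProjection]
    (hKL : ∀ α β, ∀ x ∈ L β, (K α).starProjection x ∈ L β) :
    IsOrthogonalDecomposition fun i : κ × ν => K i.1 ⊓ L i.2 where
  closed i := (h.closed i.1).inter (hL.closed i.2)
  ortho i j hne := by
    obtain h₁ | h₂ := not_and_or.1 (mt Prod.ext_iff.2 hne)
    · exact (h.ortho _ _ h₁).mono inf_le_left inf_le_left
    · exact (hL.ortho _ _ h₂).mono inf_le_right inf_le_right
  total := topologicalClosure_iSup_eq_top_iff.2 fun x hx => by
    refine hL.eq_zero_of_forall_mem_orthogonal fun β => ?_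
    have := hL.hasOrthogonalProjection β
    refine (L β).starProjection_apply_eq_zero_iff.1 (h.eq_zero_of_forall_mem_orthogonal fun α => ?_)
    have hKLx := hKL α β _ ((L β).starProjection_apply_mem x)
    refine mem_orthogonal_of_inner_starProjection_eq_zero ?_
    rw [← Submodule.inner_starProjection_left_eq_right, Submodule.starProjection_eq_self_iff.2 hKLx]
    exact hx (α, β) _ ⟨(K α).starProjection_apply_mem _, hKLx⟩

theorem isReducingPair {H' : Type*} [NormedAddCommGroup H'] [InnerProductSpace ℂ H']
    [CompleteSpace H'] {L : κ → Submodule ℂ H'} (hL : ∀ α β, α ≠ β → L α ⟂ L β)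
    {T : H →L[ℂ] H'} (hT : ∀ α, ∀ x ∈ K α, T x ∈ L α) (α : κ) : IsReducingPair T (K α) (L α) where
  map_mem := hT α
  adjoint_mem y hy := h.mem_of_forall_ne_mem_orthogonal fun β hne x hx => by
    rw [ContinuousLinearMap.adjoint_inner_right]
    exact hL α β hne.symm hy _ (hT β x hx)

/-- `T x = μ x` passes to the components of `x`, and these are proportional to `x` when `μ` is a
simple eigenvalue. -/
theorem exists_mem_of_finrank_eigenspace_eq_one {T : H →L[ℂ] H}
    (hT : ∀ α, IsReducingPair T (K α) (K α)) {μ : ℂ}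
    (hμ : Module.finrank ℂ (Module.End.eigenspace (T : Module.End ℂ H) μ) = 1) {x : H}
    (hx : Module.End.HasEigenvector (T : Module.End ℂ H) μ x) : ∃ α, x ∈ K α := by
  by_contra! hc
  refine hx.2 (h.eq_zero_of_forall_mem_orthogonal fun α => ?_)
  have := h.hasOrthogonalProjection α
  by_contra hne
  have hPx := (hT α).starProjection_mem_eigenspace hx.1
  obtain ⟨a, ha⟩ := (finrank_eq_one_iff_of_nonzero' ⟨_, hPx⟩ fun h0 =>
    hne ((K α).starProjection_apply_eq_zero_iff.1 (congrArg Subtype.val h0))).1 hμ ⟨x, hx.1⟩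
  have hax : a • (K α).starProjection x = x := congrArg Subtype.val ha
  exact hc α (hax ▸ (K α).smul_mem a ((K α).starProjection_apply_mem x))

end IsOrthogonalDecomposition

theorem mem_orthogonal_of_forall_inner_hilbertBasis_eq_zero {𝕜 E ι : Type*} [RCLike 𝕜]
    [NormedAddCommGroup E] [InnerProductSpace 𝕜 E] {K : Submodule 𝕜 E} (b : HilbertBasis ι 𝕜 K)
    {x : E} (hx : ∀ i, ⟪(b i : E), x⟫_𝕜 = 0) : x ∈ Kᗮ := fun y hy => by
  have hsum := ((b.hasSum_repr ⟨y, hy⟩).mapL K.subtypeL).mapL (innerSL 𝕜 x)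
  simp only [map_smul, Submodule.subtypeL_apply, innerSL_apply_apply, inner_eq_zero_symm.1 (hx _),
    smul_zero] at hsum
  exact inner_eq_zero_symm.1 (hsum.unique hasSum_zero)

namespace IsOrthogonalDecomposition

variable [CompleteSpace H] {κ : Type*} {K : κ → Submodule ℂ H} (h : IsOrthogonalDecomposition K)
include h

theorem exists_hilbertBasis :
    ∃ (ι : Type u) (b : HilbertBasis ι ℂ H), ∀ q, ∃ α, b q ∈ K α := by
  have : ∀ α, CompleteSpace (K α) := fun α => (h.closed α).completeSpace_coe
  choose s b _ using fun α => _root_.exists_hilbertBasis ℂ (K α)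
  let v : (Σ α, s α) → H := fun a => (b a.1 a.2 : K a.1)
  have hv : Orthonormal ℂ v :=
    (OrthogonalFamily.of_pairwise fun α β => h.ortho α β).orthonormal_sigma_orthonormal
      fun α => (b α).orthonormal
  have hspan : (Submodule.span ℂ (Set.range ((↑) : Set.range v → H)))ᗮ = ⊥ := by
    rw [Subtype.range_coe]
    refine (Submodule.eq_bot_iff _).2 fun x hx => h.eq_zero_of_forall_mem_orthogonal fun α => ?_
    exact mem_orthogonal_of_forall_inner_hilbertBasis_eq_zero (b α) fun i =>
      hx _ (Submodule.subset_span ⟨⟨α, i⟩, rfl⟩)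
  refine ⟨Set.range v, HilbertBasis.mkOfOrthogonalEqBot hv.toSubtypeRange hspan, ?_⟩
  rw [HilbertBasis.coe_mkOfOrthogonalEqBot]
  rintro ⟨_, a, rfl⟩
  exact ⟨a.1, (b a.1 a.2).2⟩

end IsOrthogonalDecomposition

end OrthogonalDecomposition

section SingularDecomposition

variable {H₁ H₂ : Type*}
  [NormedAddCommGroup H₁] [InnerProductSpace ℂ H₁]
  [NormedAddCommGroup H₂] [InnerProductSpace ℂ H₂]
  {Γ : H₂ →L[ℂ] H₁} {ι : Type*} {γ : ι → ℝ} {g : ι → H₁} {g' : ι → H₂}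

namespace IsSingularDecomposition

variable (hΓ : IsSingularDecomposition Γ γ g g')
include hΓ

theorem sqrt_ne_zero (q : ι) : (Real.sqrt (γ q) : ℂ) ≠ 0 :=
  Complex.ofReal_ne_zero.2 (Real.sqrt_pos.2 (hΓ.pos q)).ne'

theorem inner_left_apply (q : ι) (v : H₂) :
    ⟪g q, Γ v⟫_ℂ = (Real.sqrt (γ q) : ℂ) * ⟪g' q, v⟫_ℂ := by
  refine (((hΓ.hasSum v).mapL (innerSL ℂ (g q))).unique (hasSum_single q fun p hp => ?_)).trans ?_
  · rw [innerSL_apply_apply, inner_smul_right, hΓ.orthonormal_left.2 hp.symm, mul_zero]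
  · rw [innerSL_apply_apply, inner_smul_right, inner_self_eq_norm_sq_to_K,
      hΓ.orthonormal_left.1 q, RCLike.ofReal_one, one_pow, mul_one]

theorem apply_right (q : ι) : Γ (g' q) = (Real.sqrt (γ q) : ℂ) • g q := by
  refine ((hΓ.hasSum (g' q)).unique (hasSum_single q fun p hp => ?_)).trans ?_
  · rw [hΓ.orthonormal_right.2 hp, mul_zero, zero_smul]
  · rw [inner_self_eq_norm_sq_to_K, hΓ.orthonormal_right.1 q, RCLike.ofReal_one, one_pow, mul_one]

theorem apply_mem {K : Submodule ℂ H₁} (hK : IsClosed (K : Set H₁)) {v : H₂}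
    (h : ∀ q, ⟪g' q, v⟫_ℂ ≠ 0 → g q ∈ K) : Γ v ∈ K := by
  refine hK.mem_of_tendsto (hΓ.hasSum v) (.of_forall fun s => K.sum_mem fun q _ => ?_)
  obtain hq | hq := eq_or_ne ⟪g' q, v⟫_ℂ 0
  · simp [hq]
  · exact K.smul_mem _ (h q hq)

theorem comp_equiv {ι' : Type*} (e : ι' ≃ ι) :
    IsSingularDecomposition Γ (γ ∘ e) (g ∘ e) (g' ∘ e) where
  pos q := hΓ.pos (e q)
  orthonormal_left := hΓ.orthonormal_left.comp e e.injective
  orthonormal_right := hΓ.orthonormal_right.comp e e.injective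
  hasSum v := e.hasSum_iff.2 (hΓ.hasSum v)

variable [CompleteSpace H₁] [CompleteSpace H₂]

theorem adjoint_apply_left (q : ι) : (Γ†) (g q) = (Real.sqrt (γ q) : ℂ) • g' q := by
  refine ext_inner_right ℂ fun v => ?_
  rw [ContinuousLinearMap.adjoint_inner_left, hΓ.inner_left_apply, inner_smul_left,
    Complex.conj_ofReal]

theorem right_mem {K₁ : Submodule ℂ H₁} {K₂ : Submodule ℂ H₂} (h : IsReducingPair Γ K₂ K₁) {q : ι}
    (hq : g q ∈ K₁) : g' q ∈ K₂ :=
  (K₂.smul_mem_iff (hΓ.sqrt_ne_zero q)).1 (hΓ.adjoint_apply_left q ▸ h.adjoint_mem _ hq)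

theorem hasEigenvector_left (q : ι) :
    Module.End.HasEigenvector ((Γ ∘L Γ† : H₁ →L[ℂ] H₁) : Module.End ℂ H₁) (γ q) (g q) := by
  refine ⟨Module.End.mem_eigenspace_iff.2 ?_, hΓ.orthonormal_left.ne_zero q⟩
  change Γ ((Γ†) (g q)) = _
  rw [hΓ.adjoint_apply_left, map_smul, hΓ.apply_right, smul_smul, ← Complex.ofReal_mul,
    Real.mul_self_sqrt (hΓ.pos q).le]

theorem isReducingPair_top_left {K : Submodule ℂ H₁} (hK : IsClosed (K : Set H₁))
    (hg : ∀ q, g q ∈ K) : IsReducingPair Γ ⊤ K :=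
  ⟨fun _ _ => hΓ.apply_mem hK fun q _ => hg q, fun _ _ => trivial⟩

theorem isReducingPair_top_right {K : Submodule ℂ H₂} (hK : IsClosed (K : Set H₂))
    (hg' : ∀ q, g' q ∈ K) : IsReducingPair Γ K ⊤ := by
  have := hasOrthogonalProjection_of_isClosed hK
  have map_orthogonal : IsReducingPair Γ Kᗮ ⊥ :=
    ⟨fun x hx => hΓ.apply_mem isClosed_singleton fun q hq => (hq (hx _ (hg' q))).elim,
      fun y hy => by rw [(Submodule.mem_bot ℂ).1 hy, map_zero]; exact Kᗮ.zero_mem⟩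
  simpa only [Submodule.orthogonal_orthogonal, Submodule.bot_orthogonal_eq_top] using
    map_orthogonal.orthogonal

end IsSingularDecomposition

end SingularDecomposition

section Channels

variable {H₁ H₂ : Type*}
  [NormedAddCommGroup H₁] [InnerProductSpace ℂ H₁] [CompleteSpace H₁]
  [NormedAddCommGroup H₂] [InnerProductSpace ℂ H₂] [CompleteSpace H₂]
  {Ω₁ : H₁ →ₗ.[ℂ] H₁} {Ω₂ : H₂ →ₗ.[ℂ] H₂} {Γ : H₂ →L[ℂ] H₁}

namespace IsReconstructible

variable (hr : IsReconstructible Ω₁ Ω₂ Γ) (h₁ : IsSelfAdjoint Ω₁) (h₂ : IsSelfAdjoint Ω₂)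
include hr h₁ h₂

theorem eq_top_of_isReducingPair_top_left {K : Submodule ℂ H₁} (hK : IsInvariant Ω₁ K)
    (hΓ : IsReducingPair Γ ⊤ K) : K = ⊤ := by
  have hle := orbit_frequencyOperator_le h₁ h₂ hK (isInvariant_top h₂) hΓ
    (S := directSum (⊥ : Submodule ℂ H₁) (⊤ : Submodule ℂ H₂))
    fun _ hx => ⟨(bot_le : ⊥ ≤ K) hx.1, hx.2⟩
  rw [hr.from_second] at hle
  exact eq_top_iff.2 fun x _ => (hle (x := WithLp.toLp 2 (x, (0 : H₂))) trivial).1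

theorem eq_top_of_isReducingPair_top_right {K : Submodule ℂ H₂} (hK : IsInvariant Ω₂ K)
    (hΓ : IsReducingPair Γ K ⊤) : K = ⊤ := by
  have hle := orbit_frequencyOperator_le h₁ h₂ (isInvariant_top h₁) hK hΓ
    (S := directSum (⊤ : Submodule ℂ H₁) (⊥ : Submodule ℂ H₂))
    fun _ hx => ⟨hx.1, (bot_le : ⊥ ≤ K) hx.2⟩
  rw [hr.from_first] at hle
  exact eq_top_iff.2 fun x _ => (hle (x := WithLp.toLp 2 ((0 : H₁), x)) trivial).2

end IsReconstructible

section ComponentOrbit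

variable {H : Type*} [NormedAddCommGroup H] [InnerProductSpace ℂ H] [CompleteSpace H]
  {A : H →ₗ.[ℂ] H} (hA : IsSelfAdjoint A) {ι : Type*} {g : ι → H}
include hA

theorem mem_componentOrbit (G : SimpleGraph ι) (q : ι) :
    g q ∈ componentOrbit A g G (G.connectedComponentMk q) :=
  subset_orbit hA _ ⟨q, rfl, rfl⟩

theorem isOrthogonalDecomposition_componentOrbit {G : SimpleGraph ι}
    (htop : orbit A (Set.range g) = ⊤)
    (hG : ∀ p q, p ≠ q → ¬ G.Adj p q → g q ∈ (orbit A {g p})ᗮ) :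
    IsOrthogonalDecomposition (componentOrbit A g G) where
  closed _ := isClosed_orbit _ _
  ortho c c' hne := by
    have ortho_orbit_singleton : ∀ p ∈ c.supp, orbit A (g '' c'.supp) ⟂ orbit A {g p} := by
      rintro p rfl
      refine orbit_isOrtho hA ?_
      rintro _ ⟨q, rfl, rfl⟩
      exact hG p q (fun h => hne (congrArg _ h))
        fun h => hne (SimpleGraph.ConnectedComponent.sound h.reachable)
    refine orbit_isOrtho hA ?_
    rintro _ ⟨p, hp, rfl⟩
    exact (ortho_orbit_singleton p hp).symm (subset_orbit hA _ rfl)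
  total := by
    rw [eq_top_iff, ← htop]
    refine (IsReducingPair.iSup fun c => isReducingPair_orbit hA _).topologicalClosure.orbit_le
      (Submodule.isClosed_topologicalClosure _) ?_
    rintro _ ⟨q, rfl⟩
    exact Submodule.le_topologicalClosure _
      (Submodule.mem_iSup_of_mem (G.connectedComponentMk q) (mem_componentOrbit hA G q))

theorem IsOrthogonalDecomposition.eq_of_notMem_orthogonal_orbit {κ : Type*}
    {K : κ → Submodule ℂ H} (hK : IsOrthogonalDecomposition K) (hinv : ∀ α, IsInvariant A (K α))
    {α β : κ} {x y : H} (hx : x ∈ K α) (hy : y ∈ K β) (hxy : y ∉ (orbit A {x})ᗮ) : α = β := by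
  by_contra hne
  have orbit_le : orbit A {x} ≤ K α := (hinv α).orbit_le hA (Set.singleton_subset_iff.2 hx)
  exact hxy (((hK.ortho _ _ hne).mono_left orbit_le).symm hy)

end ComponentOrbit

variable {ι : Type*} {g : ι → H₁} {g' : ι → H₂}

theorem channelGraph_adj {p q : ι} :
    (channelGraph Ω₁ Ω₂ g g').Adj p q ↔ p ≠ q ∧
      ((g q ∉ (orbit Ω₁ {g p})ᗮ ∨ g' q ∉ (orbit Ω₂ {g' p})ᗮ) ∨
        (g p ∉ (orbit Ω₁ {g q})ᗮ ∨ g' p ∉ (orbit Ω₂ {g' q})ᗮ)) :=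
  SimpleGraph.fromRel_adj _ _ _

theorem mem_orthogonal_of_not_adj {p q : ι} (hne : p ≠ q)
    (h : ¬ (channelGraph Ω₁ Ω₂ g g').Adj p q) :
    g q ∈ (orbit Ω₁ {g p})ᗮ ∧ g' q ∈ (orbit Ω₂ {g' p})ᗮ := by
  rw [channelGraph_adj] at h
  tauto

variable (h₁ : IsSelfAdjoint Ω₁) (h₂ : IsSelfAdjoint Ω₂)
include h₁ h₂

theorem isSInvariantDecomposition_top :
    IsSInvariantDecomposition Ω₁ Ω₂ Γ (fun _ : Unit => ⊤) fun _ : Unit => ⊤ where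
  decomposition₁ := isOrthogonalDecomposition_top
  decomposition₂ := isOrthogonalDecomposition_top
  invariant _ := (isInvariant_directSum_iff h₁ h₂).2
    ⟨isInvariant_top h₁, isInvariant_top h₂, isReducingPair_top Γ⟩

theorem isSInvariantDecomposition_componentOrbit (hr : IsReconstructible Ω₁ Ω₂ Γ) {γ : ι → ℝ}
    (hΓ : IsSingularDecomposition Γ γ g g') :
    IsSInvariantDecomposition Ω₁ Ω₂ Γ (componentOrbit Ω₁ g (channelGraph Ω₁ Ω₂ g g'))
      (componentOrbit Ω₂ g' (channelGraph Ω₁ Ω₂ g g')) := by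
  have htop₁ : orbit Ω₁ (Set.range g) = ⊤ :=
    hr.eq_top_of_isReducingPair_top_left h₁ h₂ (isInvariant_orbit h₁ _)
      (hΓ.isReducingPair_top_left (isClosed_orbit _ _) fun q => subset_orbit h₁ _ ⟨q, rfl⟩)
  have htop₂ : orbit Ω₂ (Set.range g') = ⊤ :=
    hr.eq_top_of_isReducingPair_top_right h₁ h₂ (isInvariant_orbit h₂ _)
      (hΓ.isReducingPair_top_right (isClosed_orbit _ _) fun q => subset_orbit h₂ _ ⟨q, rfl⟩)
  have d₁ := isOrthogonalDecomposition_componentOrbit h₁ htop₁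
    fun p q hne h => (mem_orthogonal_of_not_adj (Ω₂ := Ω₂) (g' := g') hne h).1
  have d₂ := isOrthogonalDecomposition_componentOrbit h₂ htop₂
    fun p q hne h => (mem_orthogonal_of_not_adj (Ω₁ := Ω₁) (g := g) hne h).2
  have hmap : ∀ c, ∀ y ∈ componentOrbit Ω₂ g' (channelGraph Ω₁ Ω₂ g g') c,
      Γ y ∈ componentOrbit Ω₁ g (channelGraph Ω₁ Ω₂ g g') c := by
    refine fun c y hy => hΓ.apply_mem (d₁.closed c) fun q hq => subset_orbit h₁ _ ⟨q, ?_, rfl⟩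
    by_contra hqc
    exact hq (d₂.ortho c _ (Ne.symm hqc) hy _ (mem_componentOrbit h₂ _ q))
  refine ⟨d₁, d₂, fun c => ?_⟩
  have := d₁.hasOrthogonalProjection c
  have := d₂.hasOrthogonalProjection c
  exact (isInvariant_directSum_iff h₁ h₂).2
    ⟨isInvariant_orbit h₁ _, isInvariant_orbit h₂ _, d₂.isReducingPair d₁.ortho hmap c⟩

namespace IsSInvariantDecomposition

variable {κ : Type*} {K₁ : κ → Submodule ℂ H₁} {K₂ : κ → Submodule ℂ H₂}
  (hK : IsSInvariantDecomposition Ω₁ Ω₂ Γ K₁ K₂)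
include hK

theorem eq_of_channelGraph_adj {α β : κ} {p q : ι} (hp : g p ∈ K₁ α) (hp' : g' p ∈ K₂ α)
    (hq : g q ∈ K₁ β) (hq' : g' q ∈ K₂ β) (h : (channelGraph Ω₁ Ω₂ g g').Adj p q) : α = β := by
  have hinv := hK.isInvariant_and_isReducingPair h₁ h₂
  have eq₁ {α β x y} : x ∈ K₁ α → y ∈ K₁ β → y ∉ (orbit Ω₁ {x})ᗮ → α = β :=
    hK.decomposition₁.eq_of_notMem_orthogonal_orbit h₁ fun α => (hinv α).1
  have eq₂ {α β x y} : x ∈ K₂ α → y ∈ K₂ β → y ∉ (orbit Ω₂ {x})ᗮ → α = β :=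
    hK.decomposition₂.eq_of_notMem_orthogonal_orbit h₂ fun α => (hinv α).2.1
  obtain ⟨-, (h | h) | h | h⟩ := channelGraph_adj.1 h
  exacts [eq₁ hp hq h, eq₂ hp' hq' h, (eq₁ hq hp h).symm, (eq₂ hq' hp' h).symm]

theorem exists_componentOrbit_le {γ : ι → ℝ} (hΓ : IsSingularDecomposition Γ γ g g')
    (hg : ∀ q, ∃ β, g q ∈ K₁ β) (c : (channelGraph Ω₁ Ω₂ g g').ConnectedComponent) :
    ∃ β, componentOrbit Ω₁ g (channelGraph Ω₁ Ω₂ g g') c ≤ K₁ β ∧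
      componentOrbit Ω₂ g' (channelGraph Ω₁ Ω₂ g g') c ≤ K₂ β := by
  choose b hb using hg
  have hinv := hK.isInvariant_and_isReducingPair h₁ h₂
  have hb' : ∀ q, g' q ∈ K₂ (b q) := fun q => hΓ.right_mem (hinv (b q)).2.2 (hb q)
  have eq_of_reachable : ∀ p q, (channelGraph Ω₁ Ω₂ g g').Reachable p q → b p = b q := by
    rintro p q ⟨w⟩
    induction w with
    | nil => rfl
    | cons h _ ih =>
      exact (hK.eq_of_channelGraph_adj h₁ h₂ (hb _) (hb' _) (hb _) (hb' _) h).trans ih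
  obtain ⟨p, rfl⟩ := c.exists_rep
  have b_eq : ∀ q ∈ SimpleGraph.ConnectedComponent.supp (Quot.mk _ p), b q = b p := fun q hq =>
    eq_of_reachable q p (SimpleGraph.ConnectedComponent.exact hq)
  exact ⟨b p, (hinv (b p)).1.orbit_le h₁ (Set.image_subset_iff.2 fun q hq => b_eq q hq ▸ hb q),
    (hinv (b p)).2.1.orbit_le h₂ (Set.image_subset_iff.2 fun q hq => b_eq q hq ▸ hb' q)⟩

end IsSInvariantDecomposition

end Channels

section FinestDecomposition

variable {H₁ H₂ : Type*}
  [NormedAddCommGroup H₁] [InnerProductSpace ℂ H₁] [CompleteSpace H₁]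
  [NormedAddCommGroup H₂] [InnerProductSpace ℂ H₂] [CompleteSpace H₂]
  {Ω₁ : H₁ →ₗ.[ℂ] H₁} {Ω₂ : H₂ →ₗ.[ℂ] H₂} {Γ : H₂ →L[ℂ] H₁}

theorem IsFinestDecomposition.subset {D D' : Set (Submodule ℂ H₁ × Submodule ℂ H₂)}
    (h : IsFinestDecomposition Ω₁ Ω₂ Γ D) (h' : IsFinestDecomposition Ω₁ Ω₂ Γ D') : D ⊆ D' := by
  intro p hp
  obtain ⟨q, hq, hpq⟩ := h.finest D' h'.sInvariant p hp
  obtain ⟨r, hr, hqr⟩ := h'.finest D h.sInvariant q hq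
  have hpr : p = r := by
    by_contra hne
    have hne' : (⟨p, hp⟩ : D) ≠ ⟨r, hr⟩ := fun e => hne (congrArg Subtype.val e)
    have ortho₁ := h.sInvariant.decomposition₁.ortho _ _ hne'
    have ortho₂ := h.sInvariant.decomposition₂.ortho _ _ hne'
    exact h.nonzero p hp (Prod.ext
      (Submodule.isOrtho_self.1 (ortho₁.mono_right (hpq.1.trans hqr.1)))
      (Submodule.isOrtho_self.1 (ortho₂.mono_right (hpq.2.trans hqr.2))))
  subst hpr
  rwa [show p = q from le_antisymm hpq hqr]

theorem IsSInvariantDecomposition.range {κ : Type*} {K₁ : κ → Submodule ℂ H₁}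
    {K₂ : κ → Submodule ℂ H₂} (h : IsSInvariantDecomposition Ω₁ Ω₂ Γ K₁ K₂) :
    IsSInvariantDecomposition Ω₁ Ω₂ Γ
      (fun p : Set.range fun α => (K₁ α, K₂ α) => p.1.1) fun p => p.1.2 where
  decomposition₁ := .of_comp_surjective Set.rangeFactorization_surjective h.decomposition₁
  decomposition₂ := .of_comp_surjective Set.rangeFactorization_surjective h.decomposition₂
  invariant := Set.rangeFactorization_surjective.forall.2 h.invariant

variable (h₁ : IsSelfAdjoint Ω₁) (h₂ : IsSelfAdjoint Ω₂) {ι : Type*} {γ : ι → ℝ} {g : ι → H₁}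
  {g' : ι → H₂} (hΓ : IsSingularDecomposition Γ γ g g')
  (hsimple : ∀ μ : ℂ, μ ≠ 0 →
    Module.End.HasEigenvalue ((Γ ∘L Γ† : H₁ →L[ℂ] H₁) : Module.End ℂ H₁) μ →
    Module.finrank ℂ
      (Module.End.eigenspace ((Γ ∘L Γ† : H₁ →L[ℂ] H₁) : Module.End ℂ H₁) μ) = 1)
include h₁ h₂ hΓ hsimple

theorem IsSInvariantDecomposition.exists_mem_left_of_finrank_eigenspace_eq_one {κ : Type*}
    {K₁ : κ → Submodule ℂ H₁} {K₂ : κ → Submodule ℂ H₂}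
    (hK : IsSInvariantDecomposition Ω₁ Ω₂ Γ K₁ K₂) (q : ι) : ∃ α, g q ∈ K₁ α := by
  have hred α : IsReducingPair (Γ ∘L Γ†) (K₁ α) (K₁ α) :=
    have h := (hK.isInvariant_and_isReducingPair h₁ h₂ α).2.2
    h.comp h.adjoint
  have hg := hΓ.hasEigenvector_left q
  exact hK.decomposition₁.exists_mem_of_finrank_eigenspace_eq_one hred
    (hsimple _ (Complex.ofReal_ne_zero.2 (hΓ.pos q).ne')
      (Module.End.hasEigenvalue_of_hasEigenvector hg)) hg

theorem isFinestDecomposition_range_componentOrbit (hr : IsReconstructible Ω₁ Ω₂ Γ) :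
    IsFinestDecomposition Ω₁ Ω₂ Γ (Set.range fun c =>
      (componentOrbit Ω₁ g (channelGraph Ω₁ Ω₂ g g') c,
        componentOrbit Ω₂ g' (channelGraph Ω₁ Ω₂ g g') c)) where
  sInvariant := (isSInvariantDecomposition_componentOrbit h₁ h₂ hr hΓ).range
  nonzero := by
    rintro _ ⟨c, rfl⟩ hc
    obtain ⟨q, rfl⟩ := c.exists_rep
    have hq : g q ∈ (⊥ : Submodule ℂ H₁) :=
      (Prod.ext_iff.1 hc).1.le (mem_componentOrbit h₁ (channelGraph Ω₁ Ω₂ g g') q)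
    exact hΓ.orthonormal_left.ne_zero q ((Submodule.mem_bot ℂ).1 hq)
  finest := by
    rintro E hE _ ⟨c, rfl⟩
    obtain ⟨⟨q, hq⟩, hle⟩ := hE.exists_componentOrbit_le h₁ h₂ hΓ
      (hE.exists_mem_left_of_finrank_eigenspace_eq_one h₁ h₂ hΓ hsimple) c
    exact ⟨q, hq, hle⟩

theorem existsUnique_isFinestDecomposition (hr : IsReconstructible Ω₁ Ω₂ Γ) :
    ∃! D : Set (Submodule ℂ H₁ × Submodule ℂ H₂), IsFinestDecomposition Ω₁ Ω₂ Γ D :=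
  have hfinest := isFinestDecomposition_range_componentOrbit h₁ h₂ hΓ hsimple hr
  ⟨_, hfinest, fun _ hD => (hD.subset hfinest).antisymm (hfinest.subset hD)⟩

end FinestDecomposition

section StandardRepresentation

universe u

variable {H₀ : Type u} [NormedAddCommGroup H₀] [InnerProductSpace ℂ H₀]

open scoped ComplexOrder in
theorem exists_pos_of_hasEigenvector {T : H₀ →L[ℂ] H₀} (hT : T.IsPositive)
    (hinj : Function.Injective T) {μ : ℂ} {x : H₀}
    (hx : Module.End.HasEigenvector (T : Module.End ℂ H₀) μ x) : ∃ s : ℝ, 0 < s ∧ μ = s := by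
  have hTx : T x = μ • x := hx.apply_eq_smul
  have hne : μ ≠ 0 := by
    rintro rfl
    exact hx.2 (hinj (by rw [hTx, zero_smul, map_zero]))
  have hmul : 0 ≤ μ * ((‖x‖ : ℝ) : ℂ) ^ 2 := by
    have := hT.inner_nonneg_right x
    rwa [hTx, inner_smul_right, inner_self_eq_norm_sq_to_K] at this
  have hnorm : 0 < ((‖x‖ : ℝ) : ℂ) ^ 2 :=
    pow_pos (Complex.zero_lt_real.2 (norm_pos_iff.2 hx.2)) 2
  have hμ : 0 < μ := (le_of_mul_le_mul_right (by rwa [zero_mul]) hnorm).lt_of_ne' hne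
  obtain ⟨s, hs, rfl⟩ := RCLike.pos_iff_exists_ofReal.1 hμ
  exact ⟨s, hs, rfl⟩

theorem isSingularDecomposition_of_hilbertBasis {T : H₀ →L[ℂ] H₀} {ι : Type*}
    (b : HilbertBasis ι ℂ H₀) {s : ι → ℝ} (hs : ∀ q, 0 < s q)
    (hT : ∀ q, T (b q) = (s q : ℂ) • b q) :
    IsSingularDecomposition T (fun q => s q ^ 2) b b where
  pos q := pow_pos (hs q) 2
  orthonormal_left := b.orthonormal
  orthonormal_right := b.orthonormal
  hasSum x := by
    convert (b.hasSum_repr x).mapL T using 2 with q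
    rw [map_smul, hT, smul_smul, Real.sqrt_sq (hs q).le, b.repr_apply_apply, mul_comm]

variable [CompleteSpace H₀] {H₁ H₂ : Type*}
  [NormedAddCommGroup H₁] [InnerProductSpace ℂ H₁] [CompleteSpace H₁]
  [NormedAddCommGroup H₂] [InnerProductSpace ℂ H₂] [CompleteSpace H₂]
  {Γ : H₂ →L[ℂ] H₁} {U₁ : H₀ →ₗᵢ[ℂ] H₁} {U₂ : H₀ →ₗᵢ[ℂ] H₂} {Γ₀ : H₀ →L[ℂ] H₀}

namespace IsStandardRepresentation

variable (h : IsStandardRepresentation Γ U₁ U₂ Γ₀)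
include h

theorem isSymmetric : (Γ₀ : H₀ →ₗ[ℂ] H₀).IsSymmetric := fun x y => by
  change ⟪Γ₀ x, y⟫_ℂ = ⟪x, Γ₀ y⟫_ℂ
  rw [← U₂.inner_map_map, h.eq₂, ContinuousLinearMap.adjoint_inner_left, ← h.eq₁, U₁.inner_map_map]

theorem injective : Function.Injective Γ₀ := by
  refine (injective_iff_map_eq_zero Γ₀).2 fun x hx => ?_
  have mem_closure : U₁ x ∈ (LinearMap.range (Γ : H₂ →ₗ[ℂ] H₁)).topologicalClosure :=
    h.range₁ ▸ ⟨x, rfl⟩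
  have mem_orthogonal : U₁ x ∈ (LinearMap.range (Γ : H₂ →ₗ[ℂ] H₁)).topologicalClosureᗮ := by
    rw [Submodule.orthogonal_closure, ContinuousLinearMap.orthogonal_range]
    exact (h.eq₂ x).symm.trans (by rw [hx, map_zero])
  exact U₁.injective ((Submodule.disjoint_def.1 (Submodule.orthogonal_disjoint _) _ mem_closure
    mem_orthogonal).trans U₁.map_zero.symm)

theorem denseRange : DenseRange Γ₀ := by
  have hker : LinearMap.ker (Γ₀ : H₀ →ₗ[ℂ] H₀) = ⊥ := LinearMap.ker_eq_bot.2 h.injective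
  refine (Submodule.dense_iff_topologicalClosure_eq_top
    (s := LinearMap.range (Γ₀ : H₀ →ₗ[ℂ] H₀))).2 (Submodule.topologicalClosure_eq_top_iff.2 ?_)
  rw [ContinuousLinearMap.orthogonal_range, h.isSymmetric.isSelfAdjoint.adjoint_eq, hker]

theorem map_apply_eq_sqrt (x : H₀) : U₁ (Γ₀ x) = CFC.sqrt (Γ ∘L Γ†) (U₁ x) := by
  set S := CFC.sqrt (Γ ∘L Γ†)
  have sqrt_sqrt (y : H₁) : S (S y) = Γ ((Γ†) y) :=
    congrArg (fun T : H₁ →L[ℂ] H₁ => T y) (CFC.sqrt_mul_sqrt_self _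
      ((ContinuousLinearMap.nonneg_iff_isPositive _).2
        (ContinuousLinearMap.isPositive_self_comp_adjoint Γ)))
  have sqrt_eq (x : H₀) : U₁ (Γ₀ (Γ₀ (Γ₀ x))) = S (U₁ (Γ₀ (Γ₀ x))) := by
    have hx : U₁ (Γ₀ (Γ₀ x)) = S (S (U₁ x)) := by rw [h.eq₁, h.eq₂, sqrt_sqrt]
    rw [h.eq₁, h.polar _ _ hx, ← sqrt_sqrt, hx]
  have hdense : DenseRange (Γ₀ ∘ Γ₀) := h.denseRange.comp h.denseRange Γ₀.continuous
  have hcomp : U₁ ∘ Γ₀ = S ∘ U₁ :=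
    hdense.equalizer (by fun_prop) (by fun_prop) (funext sqrt_eq)
  exact congrFun hcomp x

theorem isPositive : Γ₀.IsPositive := by
  refine ⟨h.isSymmetric, fun x => ?_⟩
  have hsqrt : (CFC.sqrt (Γ ∘L Γ†)).IsPositive :=
    (ContinuousLinearMap.nonneg_iff_isPositive _).1 (CFC.sqrt_nonneg _)
  rw [ContinuousLinearMap.reApplyInnerSelf_apply, ← U₁.inner_map_map, h.map_apply_eq_sqrt]
  exact hsqrt.re_inner_nonneg_left (U₁ x)

theorem isSingularDecomposition {ι : Type*} {γ : ι → ℝ} {g₀ : ι → H₀}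
    (h₀ : IsSingularDecomposition Γ₀ γ g₀ g₀) :
    IsSingularDecomposition Γ γ (fun q => U₁ (g₀ q)) fun q => U₂ (g₀ q) where
  pos := h₀.pos
  orthonormal_left := h₀.orthonormal_left.comp_linearIsometry U₁
  orthonormal_right := h₀.orthonormal_right.comp_linearIsometry U₂
  hasSum y := by
    set M := LinearMap.range U₂.toLinearMap with hM
    have : M.HasOrthogonalProjection :=
      hasOrthogonalProjection_of_isClosed
        (by rw [hM, h.range₂]; exact Submodule.isClosed_topologicalClosure _)
    have apply_eq_zero : ∀ z ∈ Mᗮ, Γ z = 0 := fun z hz => by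
      rw [hM, h.range₂, Submodule.orthogonal_closure, ContinuousLinearMap.orthogonal_range,
        ContinuousLinearMap.adjoint_adjoint] at hz
      exact hz
    obtain ⟨x, hx : U₂ x = _⟩ := M.starProjection_apply_mem y
    have hy : y - U₂ x ∈ Mᗮ := hx ▸ M.sub_starProjection_mem_orthogonal y
    have hΓy : Γ y = U₁ (Γ₀ x) := by
      rw [h.eq₁, ← sub_eq_zero, ← map_sub, apply_eq_zero _ hy]
    have hinner : ∀ q, ⟪U₂ (g₀ q), y⟫_ℂ = ⟪g₀ q, x⟫_ℂ := fun q => by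
      rw [← U₂.inner_map_map, ← sub_eq_zero, ← inner_sub_right]
      exact hy _ ⟨g₀ q, rfl⟩
    simpa only [hΓy, hinner, map_smul, LinearIsometry.coe_toContinuousLinearMap] using
      (h₀.hasSum x).mapL U₁.toContinuousLinearMap

theorem starProjection_mem_range {K₁ : Submodule ℂ H₁} {K₂ : Submodule ℂ H₂}
    [K₁.HasOrthogonalProjection] [K₂.HasOrthogonalProjection] (hΓ : IsReducingPair Γ K₂ K₁)
    (x : H₀) : K₁.starProjection (U₁ x) ∈ LinearMap.range U₁.toLinearMap := by
  have hx : U₁ x ∈ LinearMap.range U₁.toLinearMap := ⟨x, rfl⟩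
  rw [h.range₁] at hx ⊢
  refine map_mem_closure K₁.starProjection.continuous hx ?_
  rintro _ ⟨y, rfl⟩
  exact ⟨K₂.starProjection y, hΓ.apply_starProjection y⟩

theorem isReducingPair_comap {K₁ : Submodule ℂ H₁} [K₁.HasOrthogonalProjection]
    (hK₁ : IsReducingPair (Γ ∘L Γ†) K₁ K₁) :
    IsReducingPair Γ₀ (K₁.comap U₁.toLinearMap) (K₁.comap U₁.toLinearMap) := by
  have map_mem : ∀ x ∈ K₁.comap U₁.toLinearMap, Γ₀ x ∈ K₁.comap U₁.toLinearMap := fun x hx => by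
    change U₁ (Γ₀ x) ∈ K₁
    exact h.map_apply_eq_sqrt x ▸ hK₁.sqrt.map_mem _ hx
  exact ⟨map_mem, h.isSymmetric.isSelfAdjoint.adjoint_eq.symm ▸ map_mem⟩

variable {κ : Type*} {K₁ : κ → Submodule ℂ H₁} {K₂ : κ → Submodule ℂ H₂}

theorem exists_hilbertBasis_eigenvectors (hpp : HasPurePointSpectrum Γ₀)
    (d₁ : IsOrthogonalDecomposition K₁) (d₂ : IsOrthogonalDecomposition K₂)
    (hΓ : ∀ α, IsReducingPair Γ (K₂ α) (K₁ α)) :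
    ∃ (ι : Type u) (b : HilbertBasis ι ℂ H₀) (s : ι → ℝ), (∀ q, 0 < s q) ∧
      (∀ q, Γ₀ (b q) = (s q : ℂ) • b q) ∧ ∀ q, ∃ α, U₁ (b q) ∈ K₁ α := by
  have := d₁.hasOrthogonalProjection
  have := d₂.hasOrthogonalProjection
  have d₀ := d₁.comap U₁ fun α => h.starProjection_mem_range (hΓ α)
  have := d₀.hasOrthogonalProjection
  obtain ⟨ι, b, hb⟩ := (d₀.inf (isOrthogonalDecomposition_eigenspace h.isSymmetric hpp)
    fun α _ _ => (h.isReducingPair_comap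
      ((hΓ α).comp (hΓ α).adjoint)).starProjection_mem_eigenspace).exists_hilbertBasis
  choose i hi using hb
  have hmem q := (hi q).2
  choose s hs hμ using fun q => exists_pos_of_hasEigenvector h.isPositive h.injective
    ⟨hmem q, b.orthonormal.ne_zero q⟩
  exact ⟨ι, b, s, hs, fun q => hμ q ▸ Module.End.mem_eigenspace_iff.1 (hmem q),
    fun q => ⟨_, (hi q).1⟩⟩

theorem exists_isSingularDecomposition (hpp : HasPurePointSpectrum Γ₀)
    {Ω₁ : H₁ →ₗ.[ℂ] H₁} (h₁ : IsSelfAdjoint Ω₁) {Ω₂ : H₂ →ₗ.[ℂ] H₂} (h₂ : IsSelfAdjoint Ω₂)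
    (hK : IsSInvariantDecomposition Ω₁ Ω₂ Γ K₁ K₂) :
    ∃ (ι : Type u) (γ : ι → ℝ) (g₀ : ι → H₀),
      IsSingularDecomposition Γ₀ γ g₀ g₀ ∧
      IsSingularDecomposition Γ γ (fun q => U₁ (g₀ q)) (fun q => U₂ (g₀ q)) ∧
      ∀ q, ∃ α, U₁ (g₀ q) ∈ K₁ α ∧ U₂ (g₀ q) ∈ K₂ α := by
  have hred α := (hK.isInvariant_and_isReducingPair h₁ h₂ α).2.2
  obtain ⟨ι, b, s, hs, hb, hmem⟩ :=
    h.exists_hilbertBasis_eigenvectors hpp hK.decomposition₁ hK.decomposition₂ hred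
  have hΓ₀ := isSingularDecomposition_of_hilbertBasis b hs hb
  have hΓ := h.isSingularDecomposition hΓ₀
  exact ⟨ι, _, b, hΓ₀, hΓ, fun q => (hmem q).imp fun α hα => ⟨hα, hΓ.right_mem (hred α) hα⟩⟩

end IsStandardRepresentation

end StandardRepresentation

section Countable

variable {𝕜 E : Type*} [RCLike 𝕜] [NormedAddCommGroup E] [InnerProductSpace 𝕜 E]
  [TopologicalSpace.SeparableSpace E] {ι : Type*} {v : ι → E}

theorem countable_of_orthonormal (hv : Orthonormal 𝕜 v) : Countable ι := by
  have norm_sub_sq_eq : ∀ i j, i ≠ j → ‖v i - v j‖ ^ 2 = 2 := fun i j hij => by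
    rw [norm_sub_sq (𝕜 := 𝕜), hv.2 hij, hv.1 i, hv.1 j]
    norm_num
  refine Pairwise.countable_of_isOpen_disjoint (s := fun i => Metric.ball (v i) (1 / 2))
    (fun i j hij => Metric.ball_disjoint_ball ?_) (fun i => Metric.isOpen_ball)
    (fun i => ⟨v i, Metric.mem_ball_self one_half_pos⟩)
  rw [dist_eq_norm]
  nlinarith [norm_sub_sq_eq i j hij, norm_nonneg (v i - v j)]

theorem exists_equiv_countable_of_orthonormal (hv : Orthonormal 𝕜 v) :
    ∃ (ι' : Type) (_ : Countable ι'), Nonempty (ι' ≃ ι) :=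
  have := countable_of_orthonormal hv
  ⟨Shrink.{0} ι, (equivShrink.{0} ι).symm.injective.countable, ⟨(equivShrink.{0} ι).symm⟩⟩

end Countable

end OpenSystem

theorem mainTheorem4_general.{u} {H₁ H₂ : Type*} {H₀ : Type u}
    [NormedAddCommGroup H₁] [InnerProductSpace ℂ H₁] [CompleteSpace H₁]
    [NormedAddCommGroup H₂] [InnerProductSpace ℂ H₂] [CompleteSpace H₂]
    [NormedAddCommGroup H₀] [InnerProductSpace ℂ H₀] [CompleteSpace H₀]
    (Ω₁ : H₁ →ₗ.[ℂ] H₁) (hΩ₁ : IsSelfAdjoint Ω₁)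
    (Ω₂ : H₂ →ₗ.[ℂ] H₂) (hΩ₂ : IsSelfAdjoint Ω₂)
    (Γ : H₂ →L[ℂ] H₁)
    (U₁ : H₀ →ₗᵢ[ℂ] H₁) (U₂ : H₀ →ₗᵢ[ℂ] H₂) (Γ₀ : H₀ →L[ℂ] H₀)
    (hrep : OpenSystem.IsStandardRepresentation Γ U₁ U₂ Γ₀)
    (hpp : OpenSystem.HasPurePointSpectrum Γ₀) :
    (∀ {κ : Type*} (K₁ : κ → Submodule ℂ H₁) (K₂ : κ → Submodule ℂ H₂),
      OpenSystem.IsSInvariantDecomposition Ω₁ Ω₂ Γ K₁ K₂ →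
      ∃ (ι : Type u) (γ : ι → ℝ) (g₀ : ι → H₀),
        OpenSystem.IsSingularDecomposition Γ₀ γ g₀ g₀ ∧
        OpenSystem.IsSingularDecomposition Γ γ (fun q => U₁ (g₀ q)) (fun q => U₂ (g₀ q)) ∧
        ∀ q, ∃ α, U₁ (g₀ q) ∈ K₁ α ∧ U₂ (g₀ q) ∈ K₂ α) ∧
    (OpenSystem.IsReconstructible Ω₁ Ω₂ Γ →
      ∀ {ι : Type*} (γ : ι → ℝ) (g : ι → H₁) (g' : ι → H₂),
        OpenSystem.IsSingularDecomposition Γ γ g g' →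
        OpenSystem.IsSInvariantDecomposition Ω₁ Ω₂ Γ
          (OpenSystem.componentOrbit Ω₁ g (OpenSystem.channelGraph Ω₁ Ω₂ g g'))
          (OpenSystem.componentOrbit Ω₂ g' (OpenSystem.channelGraph Ω₁ Ω₂ g g')) ∧
        (∀ q, ∃ c, g q ∈ OpenSystem.componentOrbit Ω₁ g
          (OpenSystem.channelGraph Ω₁ Ω₂ g g') c) ∧
        ∀ {κ : Type*} (L₁ : κ → Submodule ℂ H₁) (L₂ : κ → Submodule ℂ H₂),
          OpenSystem.IsSInvariantDecomposition Ω₁ Ω₂ Γ L₁ L₂ →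
          (∀ q, ∃ β, g q ∈ L₁ β) →
          ∀ c, ∃ β,
            OpenSystem.componentOrbit Ω₁ g (OpenSystem.channelGraph Ω₁ Ω₂ g g') c ≤ L₁ β ∧
            OpenSystem.componentOrbit Ω₂ g' (OpenSystem.channelGraph Ω₁ Ω₂ g g') c ≤ L₂ β) ∧
    (OpenSystem.IsReconstructible Ω₁ Ω₂ Γ →
      (∀ μ : ℂ, μ ≠ 0 →
        Module.End.HasEigenvalue
          ((Γ ∘L ContinuousLinearMap.adjoint Γ : H₁ →L[ℂ] H₁) : Module.End ℂ H₁) μ →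
        Module.finrank ℂ (Module.End.eigenspace
          ((Γ ∘L ContinuousLinearMap.adjoint Γ : H₁ →L[ℂ] H₁) : Module.End ℂ H₁) μ) = 1) →
      ∃! D : Set (Submodule ℂ H₁ × Submodule ℂ H₂),
        OpenSystem.IsFinestDecomposition Ω₁ Ω₂ Γ D) := by
  refine ⟨fun K₁ K₂ hK => hrep.exists_isSingularDecomposition hpp hΩ₁ hΩ₂ hK,
    fun hr ι γ g g' hΓ =>
      ⟨OpenSystem.isSInvariantDecomposition_componentOrbit hΩ₁ hΩ₂ hr hΓ,
        fun q => ⟨_, OpenSystem.mem_componentOrbit hΩ₁ _ q⟩,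
        fun L₁ L₂ hL hg c => hL.exists_componentOrbit_le hΩ₁ hΩ₂ hΓ hg c⟩,
    fun hr hsimple => ?_⟩
  obtain ⟨ι, γ, g₀, -, hΓ, -⟩ := hrep.exists_isSingularDecomposition hpp hΩ₁ hΩ₂
    (OpenSystem.isSInvariantDecomposition_top hΩ₁ hΩ₂)
  exact OpenSystem.existsUnique_isFinestDecomposition hΩ₁ hΩ₂ hΓ hsimple hr

theorem mainTheorem4 {H₁ H₂ H₀ : Type*}
    [NormedAddCommGroup H₁] [InnerProductSpace ℂ H₁] [CompleteSpace H₁]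
    [TopologicalSpace.SeparableSpace H₁]
    [NormedAddCommGroup H₂] [InnerProductSpace ℂ H₂] [CompleteSpace H₂]
    [TopologicalSpace.SeparableSpace H₂]
    [NormedAddCommGroup H₀] [InnerProductSpace ℂ H₀] [CompleteSpace H₀]
    (Ω₁ : H₁ →ₗ.[ℂ] H₁) (hΩ₁ : IsSelfAdjoint Ω₁)
    (Ω₂ : H₂ →ₗ.[ℂ] H₂) (hΩ₂ : IsSelfAdjoint Ω₂)
    (Γ : H₂ →L[ℂ] H₁)
    (U₁ : H₀ →ₗᵢ[ℂ] H₁) (U₂ : H₀ →ₗᵢ[ℂ] H₂) (Γ₀ : H₀ →L[ℂ] H₀)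
    (hrep : OpenSystem.IsStandardRepresentation Γ U₁ U₂ Γ₀)
    (hpp : OpenSystem.HasPurePointSpectrum Γ₀) :
    -- every s-invariant splitting admits an adapted decomposition of `Γ₀` and `Γ`
    (∀ {κ : Type*} (K₁ : κ → Submodule ℂ H₁) (K₂ : κ → Submodule ℂ H₂),
      OpenSystem.IsSInvariantDecomposition Ω₁ Ω₂ Γ K₁ K₂ →
      ∃ (ι : Type) (_ : Countable ι) (γ : ι → ℝ) (g₀ : ι → H₀),
        OpenSystem.IsSingularDecomposition Γ₀ γ g₀ g₀ ∧
        OpenSystem.IsSingularDecomposition Γ γ (fun q => U₁ (g₀ q)) (fun q => U₂ (g₀ q)) ∧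
        ∀ q, ∃ α, U₁ (g₀ q) ∈ K₁ α ∧ U₂ (g₀ q) ∈ K₂ α) ∧
    -- in a reconstructible system the channel graph gives the finest compatible decomposition
    (OpenSystem.IsReconstructible Ω₁ Ω₂ Γ →
      ∀ {ι : Type*} [Countable ι] (γ : ι → ℝ) (g : ι → H₁) (g' : ι → H₂),
        OpenSystem.IsSingularDecomposition Γ γ g g' →
        OpenSystem.IsSInvariantDecomposition Ω₁ Ω₂ Γ
          (OpenSystem.componentOrbit Ω₁ g (OpenSystem.channelGraph Ω₁ Ω₂ g g'))
          (OpenSystem.componentOrbit Ω₂ g' (OpenSystem.channelGraph Ω₁ Ω₂ g g')) ∧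
        (∀ q, ∃ c, g q ∈ OpenSystem.componentOrbit Ω₁ g
          (OpenSystem.channelGraph Ω₁ Ω₂ g g') c) ∧
        ∀ {κ : Type*} (L₁ : κ → Submodule ℂ H₁) (L₂ : κ → Submodule ℂ H₂),
          OpenSystem.IsSInvariantDecomposition Ω₁ Ω₂ Γ L₁ L₂ →
          (∀ q, ∃ β, g q ∈ L₁ β) →
          ∀ c, ∃ β,
            OpenSystem.componentOrbit Ω₁ g (OpenSystem.channelGraph Ω₁ Ω₂ g g') c ≤ L₁ β ∧
            OpenSystem.componentOrbit Ω₂ g' (OpenSystem.channelGraph Ω₁ Ω₂ g g') c ≤ L₂ β) ∧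
    -- simple singular values: the finest s-invariant decomposition is unique
    (OpenSystem.IsReconstructible Ω₁ Ω₂ Γ →
      (∀ μ : ℂ, μ ≠ 0 →
        Module.End.HasEigenvalue
          ((Γ ∘L ContinuousLinearMap.adjoint Γ : H₁ →L[ℂ] H₁) : Module.End ℂ H₁) μ →
        Module.finrank ℂ (Module.End.eigenspace
          ((Γ ∘L ContinuousLinearMap.adjoint Γ : H₁ →L[ℂ] H₁) : Module.End ℂ H₁) μ) = 1) →
      ∃! D : Set (Submodule ℂ H₁ × Submodule ℂ H₂),
        OpenSystem.IsFinestDecomposition Ω₁ Ω₂ Γ D) := by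
  have general :=
    mainTheorem4_general Ω₁ hΩ₁ Ω₂ hΩ₂ Γ U₁ U₂ Γ₀ hrep hpp
  refine ⟨fun K₁ K₂ hK => ?_, fun hr _ _ => general.2.1 hr, general.2.2⟩
  obtain ⟨w, γ, g₀, h₀, h, hmem⟩ := general.1 K₁ K₂ hK
  obtain ⟨ι, hι, ⟨e⟩⟩ := OpenSystem.exists_equiv_countable_of_orthonormal h.orthonormal_left
  exact ⟨ι, hι, γ ∘ e, g₀ ∘ e, h₀.comp_equiv e, h.comp_equiv e, fun q => hmem (e q)⟩
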